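/- **Setting.** Let $\mathcal X$ be a set of contexts, $\mathcal A$ a finite set of $K\ge 1$ arms, and $D$ a distribution of pairs $(x,r)$ with $x\in\mathcal X$ and $r\in[0,1]^{\mathcal A}$; $D_{\mathcal X}$ is the law of $x$. Let $f^*(x,a)=\mathbb E[r(a)\mid x]\in[0,1]$, and $\pi^*(x)\in\arg\max_a f^*(x,a)$. A model is a map $\mathcal X\times\mathcal A\to[0,1]$; a kernel $p$ assigns to each $x$ a distribution $p(\cdot|x)$ on $\mathcal A$; $D(p)$ is the law of $(x,a,r(a))$ when $(x,r)\sim D$ and then $a\sim p(\cdot|x)$. Let $\mathcal F_1,\dots,\mathcal F_M$ be classes of models with finite VC subgraph dimensions $1\le d_1\le\dots\le d_M$. Put $$b_i(p)=\inf_{f\in\mathcal F_i}\mathbb E_{x\sim D_{\mathcal X}}\mathbb E_{a\sim p(\cdot|x)}\big[(f(x,a)-f^*(x,a))^2\big],\qquad B_i=\sup_p b_i(p).$$ **Realizability.** Some $B_i$ is zero; $i^*$ denotes the smallest such $i\in[M]$. **Estimation oracle.** Let $C_0\ge1$, $C_1>0$ and $\xi_j(n,\zeta)=C_1d_j\ln(n)\ln(1/\zeta)/n$.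 For each $i\in[M]$ there is a map $\mathrm{EstOracle}_i$ from finite datasets to models such that for every kernel $p$, every $n\ge2$ and every $\zeta\in(0,1)$, with probability at least $1-\zeta$ over $n$ i.i.d. samples from $D(p)$, its output $\hat f$ satisfies $$\mathbb E_{x\sim D_{\mathcal X}}\mathbb E_{a\sim p(\cdot|x)}\big[(\hat f(x,a)-f^*(x,a))^2\big]\le\min_{j\le i}\big(C_0b_j(p)+\xi_j(n,\zeta/i)\big).$$ **Algorithm (Mod-IGW).** The inputs are $\tau_1\ge2$ and $\delta\in(0,1)$. Put $\tau_0=0$ and $\tau_{m+1}=2\tau_m$ for $m\ge1$; epoch $m\ge1$ consists of the rounds $\tau_{m-1}+1,\dots,\tau_m$. Let $\hat f_1\equiv0$, $\mathcal I_1=[M]$, $\gamma_1=1$. In each round $t$ of epoch $m$, a fresh $(x_t,r_t)\sim D$ is drawn, $a_t$ is sampled from $p_m(\cdot|x_t)$, and $r_t(a_t)$ is observed, where, with $\hat a\in\arg\max_a\hat f_m(x,a)$, $$p_m(a|x)=\frac1{K+\gamma_m(\hat f_m(x,\hat a)-\hat f_m(x,a))}\ \ (a\ne\hat a),\qquad p_m(\hat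 a|x)=1-\sum_{a\ne\hat a}p_m(a|x).$$ After epoch $m$, let $S_m$ be the data $(x_t,a_t,r_t(a_t))$ of that epoch, $\hat f_{m+1}=\mathrm{EstOracle}_M(S_m)$, and $\mathcal I_{m+1}=\{i\in\mathcal I_m:\mathrm{MTOracle}(i,S_m,\delta/(4Mm^2))=\mathrm{False}\}$. Let $i_{m+1}=\min\mathcal I_{m+1}$ (any fixed convention if this set is empty) and $\gamma_{m+1}=\sqrt{K/\big(8\,\xi_{i_{m+1}}(\tau_m-\tau_{m-1},\delta/(4Mm^2))\big)}$. **Misspecification test.** Let $m^*_i\in\mathbb N\cup\{\infty\}$ be the supremum of all $m\ge1$ with $\xi_i(\tau_m-\tau_{m-1},\delta/(4Mm^2))\ge C_0\min_{i'\le i}B_{i'}$ ($0$ if there is no such $m$; $\tau_\infty=\infty$). The test $\mathrm{MTOracle}$ maps a class index, a dataset and a confidence level to $\{\mathrm{True},\mathrm{False}\}$, and there are $\beta'_i\in(0,1]$ and $\beta_i\in[0,\infty]$, non-decreasing in $i$, with $\beta_0=0$, and with $\beta_i>\beta'_i\tau_{m^*_i}$ whenever $m^*_i<\infty$, such that for all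 $i\in[M]$, $m\ge1$, $\zeta\in(0,1)$: if $\tau_m\le\beta'_i\tau_{m^*_i}$ then $\Pr[\mathrm{MTOracle}(i,S_m,\zeta)=\mathrm{False}]\ge1-\zeta$; and if $\tau_m>\beta_i$ then $\Pr[\mathrm{MTOracle}(i,S_m,\zeta)=\mathrm{True}]\ge1-\zeta$. **Claim.** There is a constant $C$ depending only on $\tau_1$ and $C_1$ such that, under these assumptions, with probability at least $1-\delta$, for all rounds $t\ge3$, the cumulative regret $R_t=\sum_{s=1}^t\big[f^*(x_s,\pi^*(x_s))-f^*(x_s,a_s)\big]$ of Mod-IGW satisfies $$R_t\le C\left(\beta_{i^*-1}\ln\frac{d_{i^*}}{d_1}+\sqrt{K\,d_{i^*}\,t\,\ln(t)\,\ln\!\Big(\frac{M\ln t}{\delta}\Big)}\right),$$ where $\infty\cdot0=0$. -/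

import Mathlib

open MeasureTheory ProbabilityTheory
open scoped NNReal ENNReal

namespace ModIGW

section Basic

variable (X A : Type*) [MeasurableSpace X] [Fintype A] [MeasurableSpace A]

/-- An observation `(x, a, r(a))`. -/
abbrev Obs := X × A × ℝ

/-- A model: a (measurable) map from contexts and arms to `[0,1]`. -/
structure Model where
  toFun : X → A → ℝ
  measurable_toFun : ∀ a, Measurable fun x => toFun x a
  mem_Icc : ∀ x a, toFun x a ∈ Set.Icc (0 : ℝ) 1

/-- A probability kernel `p(a|x)`: a (possibly randomized) arm selection rule. -/
structure ProbKernel where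
  prob : X → A → ℝ
  measurable_prob : ∀ a, Measurable fun x => prob x a
  nonneg : ∀ x a, 0 ≤ prob x a
  sum_eq_one : ∀ x, ∑ a, prob x a = 1

/-- A choice of a maximizing arm, with some fixed (measurable) way of breaking ties. -/
structure ArgmaxRule where
  pick : (A → ℝ) → A
  measurable_pick : Measurable pick
  le_pick : ∀ (v : A → ℝ) (a : A), v a ≤ v (pick v)

/-- An offline estimation oracle: a (measurable) map from finite datasets to models. -/
structure EstOracle where
  fit : (n : ℕ) → (Fin n → Obs X A) → Model X A
  measurable_fit : ∀ n a, Measurable fun q : (Fin n → Obs X A) × X => (fit n q.1).toFun q.2 a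

/-- A misspecification test: `reject i n S ζ = true` means that the test, run with class index
`i`, dataset `S` of size `n` and confidence parameter `ζ`, outputs `True`, that is, it declares
the class with index `i` to be misspecified. -/
structure TestOracle where
  reject : (i n : ℕ) → (Fin n → Obs X A) → ℝ → Bool
  measurable_reject : ∀ i n ζ, Measurable fun S => reject i n S ζ

variable {X A}

/-- The model that is identically zero. -/
def Model.zero : Model X A where
  toFun := fun _ _ => 0
  measurable_toFun := fun _ => measurable_const
  mem_Icc := fun _ _ => ⟨le_refl _, zero_le_one⟩

/-- A finite set of points of `(X × A) × ℝ` is shattered by the subgraphs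
`{(x, a, y) | y < f(x, a)}` of the models `f ∈ F`. -/
def SubgraphShatters (F : Set (Model X A)) (s : Finset ((X × A) × ℝ)) : Prop :=
  ∀ t, t ⊆ s → ∃ f ∈ F, ∀ q ∈ s, (q.2 < f.toFun q.1.1 q.1.2 ↔ q ∈ t)

/-- The VC subgraph dimension of a model class. -/
noncomputable def vcSubgraphDim (F : Set (Model X A)) : ℕ∞ :=
  ⨆ (s : Finset ((X × A) × ℝ)) (_ : SubgraphShatters F s), (s.card : ℕ∞)

/-- `f*` is a version of the conditional mean reward: `f*(x,a) = E[r(a) | x]`, where `(x, r)`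
has law `D`. -/
def IsMeanReward (D : Measure (X × (A → ℝ))) (fstar : Model X A) : Prop :=
  ∀ a, (fun w : X × (A → ℝ) => fstar.toFun w.1 a) =ᵐ[D]
    D[fun w : X × (A → ℝ) => w.2 a | MeasurableSpace.comap Prod.fst inferInstance]

/-- The law `D(p)` of `(x, a, r(a))`, where `(x, r) ∼ D` and then `a ∼ p(·|x)`. -/
noncomputable def samplingLaw (D : Measure (X × (A → ℝ))) (p : ProbKernel X A) :
    Measure (Obs X A) :=
  ∑ a, (D.withDensity fun w => ENNReal.ofReal (p.prob w.1 a)).map fun w => (w.1, a, w.2 a)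

/-- `E_{x ∼ D_X} E_{a ∼ p(·|x)} (f(x,a) - f*(x,a))²`. -/
noncomputable def risk (D : Measure (X × (A → ℝ))) (fstar f : Model X A) (p : ProbKernel X A) :
    ℝ :=
  ∫ x, ∑ a, p.prob x a * (f.toFun x a - fstar.toFun x a) ^ 2 ∂(D.map Prod.fst)

/-- `b(p)`: the average squared misspecification error of the class `F` under `D(p)`. -/
noncomputable def misspec (D : Measure (X × (A → ℝ))) (fstar : Model X A)
    (F : Set (Model X A)) (p : ProbKernel X A) : ℝ :=
  ⨅ f : F, risk D fstar f p

/-- `B`: the average squared misspecification error of `F`, the worst case over all kernels. -/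
noncomputable def maxMisspec (D : Measure (X × (A → ℝ))) (fstar : Model X A)
    (F : Set (Model X A)) : ℝ :=
  ⨆ p : ProbKernel X A, misspec D fstar F p

/-- The estimation rate `ξ(n, ζ) = C₁ d ln(n) ln(1/ζ) / n` of a class of dimension `d`. -/
noncomputable def estRate (C₁ : ℝ) (d n : ℕ) (ζ : ℝ) : ℝ :=
  C₁ * d * Real.log n * Real.log (1 / ζ) / n

/-- The last round `τ_m` of epoch `m`: `τ_0 = 0`, and `τ_{m+1} = 2 τ_m` for `m ≥ 1`. -/
def epochEnd (τ₁ : ℕ) : ℕ → ℕ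
  | 0 => 0
  | 1 => τ₁
  | m + 2 => 2 * epochEnd τ₁ (m + 1)

/-- The number `τ_m - τ_{m-1}` of rounds of epoch `m`. -/
def epochLen (τ₁ m : ℕ) : ℕ := epochEnd τ₁ m - epochEnd τ₁ (m - 1)

/-- The confidence level `δ / (4 M m²)`. -/
noncomputable def conf (M : ℕ) (δ : ℝ) (m : ℕ) : ℝ := δ / (4 * M * (m : ℝ) ^ 2)

end Basic

section Kernel

variable {X A : Type*} [MeasurableSpace X] [Fintype A] [MeasurableSpace A]

open Classical in
/-- The inverse gap weighting probabilities. -/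
noncomputable def igwProb (am : ArgmaxRule A) (γ : ℝ≥0) (f : Model X A) (x : X) (a : A) : ℝ :=
  if a = am.pick (f.toFun x) then
    1 - ∑ a' ∈ Finset.univ.erase (am.pick (f.toFun x)),
      1 / ((Fintype.card A : ℝ) + γ * (f.toFun x (am.pick (f.toFun x)) - f.toFun x a'))
  else 1 / ((Fintype.card A : ℝ) + γ * (f.toFun x (am.pick (f.toFun x)) - f.toFun x a))

/-- The action selection kernel built by inverse gap weighting from the model `f` and the
exploration parameter `γ`. -/
noncomputable def igwKernel [MeasurableSingletonClass A] (am : ArgmaxRule A) (γ : ℝ≥0)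
    (f : Model X A) : ProbKernel X A where
  prob := igwProb am γ f
  measurable_prob := by
    classical
    intro a
    have hf : Measurable f.toFun := measurable_pi_iff.2 f.measurable_toFun
    have hp : Measurable fun x => am.pick (f.toFun x) := am.measurable_pick.comp hf
    have hc : ∀ b : A, MeasurableSet {x | am.pick (f.toFun x) = b} := fun b =>
      hp (measurableSet_singleton b)
    have key : igwProb am γ f = fun x a => ∑ b : A,
        Set.indicator {x | am.pick (f.toFun x) = b} (fun x =>
          if a = b then 1 - ∑ a' ∈ Finset.univ.erase b,
            1 / ((Fintype.card A : ℝ) + γ * (f.toFun x b - f.toFun x a'))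
          else 1 / ((Fintype.card A : ℝ) + γ * (f.toFun x b - f.toFun x a))) x := by
      funext x a
      rw [Finset.sum_eq_single (am.pick (f.toFun x))]
      · simp [igwProb]
      · intro b _ hb
        exact Set.indicator_of_notMem (fun h => hb h.symm) _
      · intro h
        exact absurd (Finset.mem_univ _) h
    rw [key]
    refine Finset.measurable_sum _ fun b _ => Measurable.indicator ?_ (hc b)
    have hm := f.measurable_toFun
    split_ifs
    · exact measurable_const.sub (Finset.measurable_sum _ fun a' _ => measurable_const.div
        (measurable_const.add (measurable_const.mul ((hm b).sub (hm a')))))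
    · exact measurable_const.div
        (measurable_const.add (measurable_const.mul ((hm b).sub (hm a))))
  nonneg := by
    classical
    intro x a
    have hgap : ∀ a', 0 ≤ (γ : ℝ) * (f.toFun x (am.pick (f.toFun x)) - f.toFun x a') :=
      fun a' => mul_nonneg γ.2 (sub_nonneg.2 (am.le_pick _ a'))
    have hK : (0 : ℝ) < Fintype.card A := by
      exact_mod_cast Fintype.card_pos_iff.2 ⟨a⟩
    unfold igwProb
    split_ifs
    · have h1 : ∑ a' ∈ Finset.univ.erase (am.pick (f.toFun x)),
          1 / ((Fintype.card A : ℝ) + γ * (f.toFun x (am.pick (f.toFun x)) - f.toFun x a'))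
          ≤ ∑ _a' ∈ Finset.univ.erase (am.pick (f.toFun x)), 1 / (Fintype.card A : ℝ) :=
        Finset.sum_le_sum fun a' _ =>
          one_div_le_one_div_of_le hK (le_add_of_nonneg_right (hgap a'))
      have h2 : ∑ _a' ∈ Finset.univ.erase (am.pick (f.toFun x)), 1 / (Fintype.card A : ℝ)
          ≤ ∑ _a' : A, 1 / (Fintype.card A : ℝ) :=
        Finset.sum_le_sum_of_subset_of_nonneg (Finset.erase_subset _ _)
          fun _ _ _ => by positivity
      have h3 : ∑ _a' : A, 1 / (Fintype.card A : ℝ) = 1 := by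
        simp [hK.ne']
      linarith
    · have := hgap a
      positivity
  sum_eq_one := by
    classical
    intro x
    rw [← Finset.add_sum_erase _ _ (Finset.mem_univ (am.pick (f.toFun x)))]
    have : ∑ a ∈ Finset.univ.erase (am.pick (f.toFun x)), igwProb am γ f x a
        = ∑ a' ∈ Finset.univ.erase (am.pick (f.toFun x)),
          1 / ((Fintype.card A : ℝ) + γ * (f.toFun x (am.pick (f.toFun x)) - f.toFun x a')) :=
      Finset.sum_congr rfl fun a ha => by
        rw [igwProb, if_neg (Finset.ne_of_mem_erase ha)]
    rw [this, igwProb, if_pos rfl]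
    ring

end Kernel

section Algorithm

/-! The algorithm, as a function of the sequence `z 1, z 2, …` of the observations that are made
in rounds `1, 2, …` (the value `z 0` plays no role). Class indices run from `1` to `M`; epochs are
numbered from `1`, and the values at epoch `0` play no role. -/

variable {X A : Type*} [MeasurableSpace X] [Fintype A] [MeasurableSpace A]

/-- The data `S_m` collected in epoch `m`, that is, in rounds `τ_{m-1}+1, …, τ_m`. -/
def epochData (τ₁ : ℕ) (z : ℕ → Obs X A) (m : ℕ) : Fin (epochLen τ₁ m) → Obs X A :=
  fun k => z (epochEnd τ₁ (m - 1) + 1 + k)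

/-- The estimated models: `f̂_1 = 0`, and `f̂_{m+1}` is the output of the oracle on `S_m`. -/
def fhat (τ₁ : ℕ) (est : EstOracle X A) (z : ℕ → Obs X A) : ℕ → Model X A
  | 0 => Model.zero
  | 1 => Model.zero
  | m + 2 => est.fit _ (epochData τ₁ z (m + 1))

/-- The index sets: `I_1 = [M]`, and `I_{m+1}` consists of those `i ∈ I_m` for which the test with
data `S_m` and confidence parameter `δ/(4Mm²)` outputs `False`. -/
noncomputable def indexSet (M τ₁ : ℕ) (δ : ℝ) (mt : TestOracle X A) (z : ℕ → Obs X A) :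
    ℕ → Finset ℕ
  | 0 => Finset.Icc 1 M
  | 1 => Finset.Icc 1 M
  | m + 2 => (indexSet M τ₁ δ mt z (m + 1)).filter fun i =>
      mt.reject i _ (epochData τ₁ z (m + 1)) (conf M δ (m + 1)) = false

/-- The smallest index `i_m` of the index set `I_m` (and, by convention, `M` if no index is
left). -/
noncomputable def currentIndex (M τ₁ : ℕ) (δ : ℝ) (mt : TestOracle X A) (z : ℕ → Obs X A)
    (m : ℕ) : ℕ :=
  if h : (indexSet M τ₁ δ mt z m).Nonempty then (indexSet M τ₁ δ mt z m).min' h else M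

/-- The exploration parameter `γ_{m+1,i} = √(K / (8 ξ_i(τ_m - τ_{m-1}, δ/(4Mm²))))`. -/
noncomputable def gammaNext (K M τ₁ : ℕ) (δ C₁ : ℝ) (d : ℕ → ℕ) (m i : ℕ) : ℝ≥0 :=
  ⟨√(K / (8 * estRate C₁ (d i) (epochLen τ₁ m) (conf M δ m))), Real.sqrt_nonneg _⟩

/-- The exploration parameters used: `γ_1 = 1` and `γ_{m+1} = γ_{m+1, i_{m+1}}`. -/
noncomputable def gammaUsed (M τ₁ : ℕ) (δ C₁ : ℝ) (d : ℕ → ℕ) (mt : TestOracle X A)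
    (z : ℕ → Obs X A) : ℕ → ℝ≥0
  | 0 => 1
  | 1 => 1
  | m + 2 => gammaNext (Fintype.card A) M τ₁ δ C₁ d (m + 1)
      (currentIndex M τ₁ δ mt z (m + 2))

/-- The action selection kernel `p_m` of epoch `m`. -/
noncomputable def epochKernel [MeasurableSingletonClass A] (M τ₁ : ℕ) (δ C₁ : ℝ) (d : ℕ → ℕ)
    (am : ArgmaxRule A) (est : EstOracle X A) (mt : TestOracle X A) (z : ℕ → Obs X A) (m : ℕ) :
    ProbKernel X A :=
  igwKernel am (gammaUsed M τ₁ δ C₁ d mt z m) (fhat τ₁ est z m)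

/-- The random observations `z 1, z 2, …` on the probability space `(Ω, P)` are produced by running
the algorithm in the environment `D`: for every round `t` of every epoch `m`, the conditional
law of `z t = (x_t, a_t, r_t(a_t))` given the observations of rounds `1, …, t-1` is `D(p_m)`. -/
structure IsRun [MeasurableSingletonClass A] {Ω : Type*} [MeasurableSpace Ω] (P : Measure Ω)
    (D : Measure (X × (A → ℝ))) (M τ₁ : ℕ) (δ C₁ : ℝ) (d : ℕ → ℕ) (am : ArgmaxRule A)
    (est : EstOracle X A) (mt : TestOracle X A) (z : ℕ → Ω → Obs X A) : Prop where
  measurable : ∀ t, Measurable (z t)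
  condLaw : ∀ m, 1 ≤ m → ∀ t, epochEnd τ₁ (m - 1) < t → t ≤ epochEnd τ₁ m →
    ∀ U : Set (Obs X A), MeasurableSet U →
      P⟦z t ⁻¹' U | ⨆ s ∈ Finset.Icc 1 (t - 1), MeasurableSpace.comap (z s) inferInstance⟧
        =ᵐ[P] fun ω =>
          (samplingLaw D (epochKernel M τ₁ δ C₁ d am est mt (fun s => z s ω) m)).real U

/-- The cumulative regret `R_t = ∑_{s ≤ t} (f*(x_s, π*(x_s)) - f*(x_s, a_s))`, where `π*(x)`
maximizes `f*(x, ·)`. -/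
noncomputable def regret (fstar : Model X A) (am : ArgmaxRule A) (z : ℕ → Obs X A) (t : ℕ) : ℝ :=
  ∑ s ∈ Finset.Icc 1 t,
    (fstar.toFun (z s).1 (am.pick (fstar.toFun (z s).1)) - fstar.toFun (z s).1 (z s).2.1)

end Algorithm

section Assumptions

variable {X A : Type*} [MeasurableSpace X] [Fintype A] [MeasurableSpace A]

/-- The requirement on the estimation oracles: for every kernel `p`, with probability at least
`1 - ζ` over `n` i.i.d. samples from `D(p)`, the output of the `i`-th oracle has risk at most
`min_{j ≤ i} (C₀ b_j(p) + ξ_j(n, ζ/i))`. -/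
def EstGuarantee (D : Measure (X × (A → ℝ))) (fstar : Model X A) (M : ℕ)
    (F : ℕ → Set (Model X A)) (d : ℕ → ℕ) (C₀ C₁ : ℝ) (est : ℕ → EstOracle X A) : Prop :=
  ∀ i ∈ Finset.Icc 1 M, ∀ (p : ProbKernel X A) (n : ℕ), 2 ≤ n → ∀ ζ ∈ Set.Ioo (0 : ℝ) 1,
    ENNReal.ofReal (1 - ζ) ≤ Measure.pi (fun _ : Fin n => samplingLaw D p)
      {S | ∀ j ∈ Finset.Icc 1 i, risk D fstar ((est i).fit n S) p
        ≤ C₀ * misspec D fstar (F j) p + estRate C₁ (d j) n (ζ / i)}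

/-- The safe epoch `m*_i`: the largest `m ≥ 1` with
`ξ_i(τ_m - τ_{m-1}, δ/(4Mm²)) ≥ C₀ min_{i' ≤ i} B_{i'}`. It is `⊤` if there are arbitrarily large
such `m`, and `0` if there is none. -/
noncomputable def safeEpoch (D : Measure (X × (A → ℝ))) (fstar : Model X A) (M τ₁ : ℕ)
    (F : ℕ → Set (Model X A)) (d : ℕ → ℕ) (C₀ C₁ δ : ℝ) (i : ℕ) : ℕ∞ :=
  sSup ((fun m : ℕ => (m : ℕ∞)) '' {m | 1 ≤ m ∧
    C₀ * (⨅ i' : Finset.Icc 1 i, maxMisspec D fstar (F i'))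
      ≤ estRate C₁ (d i) (epochLen τ₁ m) (conf M δ m)})

/-- `τ_m` for an epoch `m` that may be infinite. -/
noncomputable def epochEndTop (τ₁ : ℕ) (m : ℕ∞) : ℝ≥0∞ :=
  if m = ⊤ then ⊤ else (epochEnd τ₁ m.toNat : ℝ≥0∞)

/-- The requirement on the misspecification test, for the data of the run `z` on `(Ω, P)`, with
parameters `β'_i ∈ (0, 1]` and `β_i`. The numbers `β_i` are non-decreasing, exceed
`β'_i τ_{m*_i}` when this is finite, and may be infinite (they have to be, for instance, if the
class `i` is realizable, since then `m*_i` is infinite). -/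
structure TestGuarantee {Ω : Type*} [MeasurableSpace Ω] (P : Measure Ω)
    (z : ℕ → Ω → Obs X A) (D : Measure (X × (A → ℝ))) (fstar : Model X A) (M τ₁ : ℕ)
    (F : ℕ → Set (Model X A)) (d : ℕ → ℕ) (C₀ C₁ δ : ℝ) (mt : TestOracle X A)
    (β' : ℕ → ℝ) (β : ℕ → ℝ≥0∞) : Prop where
  accept : ∀ i ∈ Finset.Icc 1 M, ∀ m, 1 ≤ m → ∀ ζ ∈ Set.Ioo (0 : ℝ) 1,
    (epochEnd τ₁ m : ℝ≥0∞) ≤ ENNReal.ofReal (β' i)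
        * epochEndTop τ₁ (safeEpoch D fstar M τ₁ F d C₀ C₁ δ i) →
      ENNReal.ofReal (1 - ζ) ≤
        P {ω | mt.reject i _ (epochData τ₁ (fun s => z s ω) m) ζ = false}
  reject : ∀ i ∈ Finset.Icc 1 M, ∀ m, 1 ≤ m → ∀ ζ ∈ Set.Ioo (0 : ℝ) 1,
    β i < (epochEnd τ₁ m : ℝ≥0∞) →
      ENNReal.ofReal (1 - ζ) ≤
        P {ω | mt.reject i _ (epochData τ₁ (fun s => z s ω) m) ζ = true}
  betaPrime_mem : ∀ i ∈ Finset.Icc 1 M, β' i ∈ Set.Ioc (0 : ℝ) 1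
  beta_zero : β 0 = 0
  beta_mono : ∀ i j, 1 ≤ i → i ≤ j → j ≤ M → β i ≤ β j
  lt_beta : ∀ i ∈ Finset.Icc 1 M, safeEpoch D fstar M τ₁ F d C₀ C₁ δ i ≠ ⊤ →
    ENNReal.ofReal (β' i) * epochEndTop τ₁ (safeEpoch D fstar M τ₁ F d C₀ C₁ δ i) < β i

end Assumptions

end ModIGW

open ModIGW

/-! On a single event of probability at least 1 - δ, all tests, all estimates and the concentration
of the regret succeed at every epoch and round (`IsRun.one_sub_le_measure_good`); on that event the
bound is deterministic.

Estimation does not suffer from model selection: every estimate after the initial zero model comes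
from the oracle of index M, whose minimum contains the term of i*, and that term reduces to the rate
of class i* because B_{i*} = 0. The selected index only sets the exploration parameter γ, so it
suffices that the selected dimension lies within a factor 3 of d_{i*}. The safe epoch of i* is
infinite, so i* is never rejected and the selected index never exceeds it. If d_{i*} ≤ 3 d_1, the
factor 3 is automatic. Otherwise the smaller classes are rejected once an epoch ends after β_{i*-1};
the rounds before that cost O(τ₁ + β_{i*-1}), and ln(d_{i*}/d_1) ≥ 1 absorbs this cost. Nothing else
is needed for the logarithmic factor (`exists_start_epoch`).

From that epoch on, inverse gap weighting is analysed through gaps averaged over arbitrary kernels.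
A small risk under p_m controls the absolute error under any kernel q, at a price that grows with
the gap of q. Hence if the gaps of f̂_m and f* agree up to a factor 2 and an additive ε_m, the same
holds in epoch m+1 with ε_{m+1} ≤ 8 y_m + ε_m / 3, where y_m is √(K ξ) at the rate of epoch m-1
(`expGap_comparison_step`). The induction starts from the trivial ε = 1, so it needs no accuracy
from earlier epochs. The contraction by 1/3 outweighs the doubling of the epochs, and the regret
sums to O(√t) up to logarithms (`sum_epochs_le`, `sum_expGap_le`).

The probabilistic input is that p_m is fixed by the data before epoch m. Given that past, the data
of the epoch are i.i.d., so the oracle guarantee applies (`HasStepLaws.lintegral_block`), and the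
regret exceeds its conditional means by at most an Azuma–Hoeffding term
(`HasStepLaws.measure_sum_gt_le`). -/

namespace ModIGW

/-! ### Joint measurability of the algorithm in data and context, and integration against D(p) -/

section Measurability

variable {X A : Type*} [MeasurableSpace X] [Fintype A] [MeasurableSpace A]

omit [Fintype A] in
lemma measurable_epochData (τ₁ m : ℕ) :
    Measurable fun z : ℕ → Obs X A => epochData τ₁ z m :=
  measurable_pi_lambda _ fun _ => measurable_pi_apply _

omit [Fintype A] in
lemma measurable_fhat (τ₁ : ℕ) (est : EstOracle X A) (m : ℕ) (a : A) :
    Measurable fun q : (ℕ → Obs X A) × X => (fhat τ₁ est q.1 m).toFun q.2 a := by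
  match m with
  | 0 => exact measurable_const
  | 1 => exact measurable_const
  | m + 2 =>
    exact (est.measurable_fit _ a).comp
      (((measurable_epochData τ₁ (m + 1)).comp measurable_fst).prodMk measurable_snd)

omit [Fintype A] in
lemma measurableSet_mem_indexSet (M τ₁ : ℕ) (δ : ℝ) (mt : TestOracle X A) (i : ℕ) :
    ∀ m, MeasurableSet {z : ℕ → Obs X A | i ∈ indexSet M τ₁ δ mt z m}
  | 0 => by simp [indexSet]
  | 1 => by simp [indexSet]
  | m + 2 => by
    simp only [indexSet, Finset.mem_filter]
    refine (measurableSet_mem_indexSet M τ₁ δ mt i (m + 1)).inter ?_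
    exact ((mt.measurable_reject i _ _).comp (measurable_epochData τ₁ (m + 1)))
      (measurableSet_singleton false)

-- The index set takes values in the countable type `Finset ℕ`, so with the discrete σ-algebra there
-- every function of it is measurable. This covers the minimum and the convention for the empty set
-- at once.
omit [Fintype A] in
lemma measurable_comp_indexSet {Y : Type*} [MeasurableSpace Y] (M τ₁ : ℕ) (δ : ℝ)
    (mt : TestOracle X A) (m : ℕ) (g : Finset ℕ → Y) :
    Measurable fun z : ℕ → Obs X A => g (indexSet M τ₁ δ mt z m) := by
  let _ : MeasurableSpace (Finset ℕ) := ⊤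
  have h : Measurable fun z : ℕ → Obs X A => indexSet M τ₁ δ mt z m := by
    refine measurable_to_countable' fun S => ?_
    have : (fun z : ℕ → Obs X A => indexSet M τ₁ δ mt z m) ⁻¹' {S} =
        ⋂ i, {z | i ∈ indexSet M τ₁ δ mt z m ↔ i ∈ S} := by
      ext z
      simp [Finset.ext_iff]
    rw [this]
    refine MeasurableSet.iInter fun i => ?_
    by_cases hi : i ∈ S
    · simpa [hi] using measurableSet_mem_indexSet M τ₁ δ mt i m
    · simp only [hi, iff_false]
      exact (measurableSet_mem_indexSet M τ₁ δ mt i m).compl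
  exact (measurable_from_top (f := g)).comp h

lemma measurable_gammaUsed (M τ₁ : ℕ) (δ C₁ : ℝ) (d : ℕ → ℕ) (mt : TestOracle X A) (m : ℕ) :
    Measurable fun z : ℕ → Obs X A => gammaUsed M τ₁ δ C₁ d mt z m := by
  match m with
  | 0 => exact measurable_const
  | 1 => exact measurable_const
  | m + 2 =>
    exact measurable_comp_indexSet M τ₁ δ mt (m + 2) fun S =>
      gammaNext (Fintype.card A) M τ₁ δ C₁ d (m + 1) (if h : S.Nonempty then S.min' h else M)

/-- Both γ and the model are random along a run, so measurability is needed jointly in the data and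
the context. Splitting over the finitely many values of the greedy arm leaves explicit measurable
expressions. -/
lemma measurable_igwProb [MeasurableSingletonClass A] {Y : Type*} [MeasurableSpace Y]
    (am : ArgmaxRule A) {γ : Y → ℝ≥0} {f : Y → Model X A} (hγ : Measurable γ)
    (hf : ∀ a, Measurable fun q : Y × X => (f q.1).toFun q.2 a) (a : A) :
    Measurable fun q : Y × X => igwProb am (γ q.1) (f q.1) q.2 a := by
  classical
  have hp : Measurable fun q : Y × X => am.pick ((f q.1).toFun q.2) :=
    am.measurable_pick.comp (measurable_pi_iff.2 hf)
  have hg : Measurable fun q : Y × X => (γ q.1 : ℝ) := (hγ.comp measurable_fst).coe_nnreal_real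
  have key : (fun q : Y × X => igwProb am (γ q.1) (f q.1) q.2 a) = fun q => ∑ b : A,
      Set.indicator {q : Y × X | am.pick ((f q.1).toFun q.2) = b} (fun q =>
        if a = b then 1 - ∑ a' ∈ Finset.univ.erase b,
          1 / ((Fintype.card A : ℝ) + γ q.1 * ((f q.1).toFun q.2 b - (f q.1).toFun q.2 a'))
        else 1 / ((Fintype.card A : ℝ) +
          γ q.1 * ((f q.1).toFun q.2 b - (f q.1).toFun q.2 a))) q := by
    funext q
    rw [Finset.sum_eq_single (am.pick ((f q.1).toFun q.2))]
    · simp [igwProb]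
    · intro b _ hb
      exact Set.indicator_of_notMem (fun h => hb h.symm) _
    · intro h
      exact absurd (Finset.mem_univ _) h
  rw [key]
  refine Finset.measurable_sum _ fun b _ => Measurable.indicator ?_ (hp (measurableSet_singleton b))
  split_ifs
  · exact measurable_const.sub (Finset.measurable_sum _ fun a' _ => measurable_const.div
      (measurable_const.add (hg.mul ((hf b).sub (hf a')))))
  · exact measurable_const.div (measurable_const.add (hg.mul ((hf b).sub (hf a))))

lemma measurable_epochKernel [MeasurableSingletonClass A] (M τ₁ : ℕ) (δ C₁ : ℝ) (d : ℕ → ℕ)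
    (am : ArgmaxRule A) (est : EstOracle X A) (mt : TestOracle X A) (m : ℕ) (a : A) :
    Measurable fun q : (ℕ → Obs X A) × X =>
      (epochKernel M τ₁ δ C₁ d am est mt q.1 m).prob q.2 a :=
  measurable_igwProb am (f := fun z => fhat τ₁ est z m) (measurable_gammaUsed M τ₁ δ C₁ d mt m)
    (fun a => measurable_fhat τ₁ est m a) a

omit [Fintype A] in
lemma measurable_obs_mk (a : A) : Measurable fun w : X × (A → ℝ) => ((w.1, a, w.2 a) : Obs X A) :=
  measurable_fst.prodMk (measurable_const.prodMk ((measurable_pi_apply a).comp measurable_snd))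

omit [MeasurableSpace A] in
lemma ProbKernel.prob_le_one (p : ProbKernel X A) (x : X) (a : A) : p.prob x a ≤ 1 := by
  rw [← p.sum_eq_one x]
  exact Finset.single_le_sum (fun b _ => p.nonneg x b) (Finset.mem_univ a)

lemma lintegral_samplingLaw (D : Measure (X × (A → ℝ))) (p : ProbKernel X A)
    {φ : Obs X A → ℝ≥0∞} (hφ : Measurable φ) :
    ∫⁻ o, φ o ∂samplingLaw D p =
      ∑ a, ∫⁻ w, ENNReal.ofReal (p.prob w.1 a) * φ (w.1, a, w.2 a) ∂D := by
  rw [samplingLaw, lintegral_finsetSum_measure]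
  refine Finset.sum_congr rfl fun a _ => ?_
  have h1 : Measurable fun w : X × (A → ℝ) => p.prob w.1 a :=
    (p.measurable_prob a).comp measurable_fst
  rw [lintegral_map hφ (measurable_obs_mk a)]
  exact lintegral_withDensity_eq_lintegral_mul _ h1.ennreal_ofReal (hφ.comp (measurable_obs_mk a))

lemma isProbabilityMeasure_samplingLaw (D : Measure (X × (A → ℝ))) [IsProbabilityMeasure D]
    (p : ProbKernel X A) : IsProbabilityMeasure (samplingLaw D p) := by
  constructor
  rw [← lintegral_one, lintegral_samplingLaw D p measurable_const]
  simp only [mul_one]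
  have h1 : ∀ a, Measurable fun w : X × (A → ℝ) => ENNReal.ofReal (p.prob w.1 a) := fun a =>
    ((p.measurable_prob a).comp measurable_fst).ennreal_ofReal
  rw [← lintegral_finsetSum _ fun a _ => h1 a]
  have : ∀ w : X × (A → ℝ), ∑ a, ENNReal.ofReal (p.prob w.1 a) = 1 := fun w => by
    rw [← ENNReal.ofReal_sum_of_nonneg fun a _ => p.nonneg _ _, p.sum_eq_one,
      ENNReal.ofReal_one]
  simp [this]

lemma measurable_samplingLaw {Y : Type*} [MeasurableSpace Y] (D : Measure (X × (A → ℝ)))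
    [IsProbabilityMeasure D] {p : Y → ProbKernel X A}
    (hp : ∀ a, Measurable fun q : Y × X => (p q.1).prob q.2 a) :
    Measurable fun y => samplingLaw D (p y) := by
  refine Measure.measurable_of_measurable_coe _ fun U hU => ?_
  have : (fun y => samplingLaw D (p y) U) = fun y => ∑ a, ∫⁻ w,
      ENNReal.ofReal ((p y).prob w.1 a) * U.indicator 1 (w.1, a, w.2 a) ∂D := by
    funext y
    rw [← lintegral_samplingLaw D (p y) (measurable_one.indicator hU), lintegral_indicator_one hU]
  rw [this]
  refine Finset.measurable_sum _ fun a _ => Measurable.lintegral_prod_right' (ν := D)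
    (f := fun q : Y × (X × (A → ℝ)) =>
      ENNReal.ofReal ((p q.1).prob q.2.1 a) * U.indicator 1 (q.2.1, a, q.2.2 a)) ?_
  refine Measurable.mul ?_ ?_
  · exact ((hp a).comp
      (measurable_fst.prodMk (measurable_fst.comp measurable_snd))).ennreal_ofReal
  · exact (measurable_one.indicator hU).comp ((measurable_obs_mk a).comp measurable_snd)

/-- The expectation of a function of context and action under `D(p)`. -/
lemma integral_samplingLaw (D : Measure (X × (A → ℝ))) [IsProbabilityMeasure D]
    (p : ProbKernel X A) {g : X → A → ℝ} (hg : ∀ a, Measurable fun x => g x a)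
    (hgm : Measurable fun o : Obs X A => g o.1 o.2.1) (hg0 : ∀ x a, 0 ≤ g x a) :
    ∫ o, g o.1 o.2.1 ∂samplingLaw D p = ∫ x, ∑ a, p.prob x a * g x a ∂(D.map Prod.fst) := by
  have hm : Measurable fun x => ∑ a, p.prob x a * g x a :=
    Finset.measurable_sum _ fun a _ => (p.measurable_prob a).mul (hg a)
  rw [integral_eq_lintegral_of_nonneg_ae (Filter.Eventually.of_forall fun o => hg0 _ _)
      hgm.aestronglyMeasurable,
    integral_eq_lintegral_of_nonneg_ae (Filter.Eventually.of_forall fun x =>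
      Finset.sum_nonneg fun a _ => mul_nonneg (p.nonneg x a) (hg0 x a)) hm.aestronglyMeasurable,
    lintegral_samplingLaw D p hgm.ennreal_ofReal, lintegral_map hm.ennreal_ofReal measurable_fst]
  congr 1
  rw [← lintegral_finsetSum]
  · refine lintegral_congr fun w => ?_
    rw [ENNReal.ofReal_sum_of_nonneg fun a _ => mul_nonneg (p.nonneg _ a) (hg0 _ a)]
    exact Finset.sum_congr rfl fun a _ => (ENNReal.ofReal_mul (p.nonneg _ a)).symm
  · intro a _
    exact ((p.measurable_prob a).comp measurable_fst).ennreal_ofReal.mul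
      ((hg a).comp measurable_fst).ennreal_ofReal

omit [MeasurableSpace A] in
lemma measurable_risk {Y : Type*} [MeasurableSpace Y] (D : Measure (X × (A → ℝ)))
    [IsProbabilityMeasure D] (fstar : Model X A) {p : Y → ProbKernel X A} {f : Y → Model X A}
    (hp : ∀ a, Measurable fun q : Y × X => (p q.1).prob q.2 a)
    (hf : ∀ a, Measurable fun q : Y × X => (f q.1).toFun q.2 a) :
    Measurable fun y => risk D fstar (f y) (p y) := by
  have h : Measurable fun q : Y × X => ∑ a, (p q.1).prob q.2 a *
      ((f q.1).toFun q.2 a - fstar.toFun q.2 a) ^ 2 :=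
    Finset.measurable_sum _ fun a _ => (hp a).mul
      (((hf a).sub ((fstar.measurable_toFun a).comp measurable_snd)).pow_const 2)
  exact (h.stronglyMeasurable.integral_prod_right' (ν := D.map Prod.fst)).measurable

end Measurability

/-! ### Arithmetic of the doubling epochs -/

section Epochs

lemma epochEnd_succ_succ (τ₁ m : ℕ) : epochEnd τ₁ (m + 2) = 2 * epochEnd τ₁ (m + 1) := rfl

lemma epochEnd_succ (τ₁ m : ℕ) : epochEnd τ₁ (m + 1) = τ₁ * 2 ^ m := by
  induction m with
  | zero => simp [epochEnd]
  | succ m ih => rw [epochEnd_succ_succ, ih]; ring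

lemma epochEnd_mono (τ₁ : ℕ) : Monotone (epochEnd τ₁) := by
  refine monotone_nat_of_le_succ fun m => ?_
  cases m with
  | zero => simp [epochEnd]
  | succ m => rw [epochEnd_succ_succ]; omega

lemma epochLen_succ_succ (τ₁ m : ℕ) : epochLen τ₁ (m + 2) = epochEnd τ₁ (m + 1) := by
  simp [epochLen, epochEnd_succ_succ]; omega

lemma epochLen_one (τ₁ : ℕ) : epochLen τ₁ 1 = τ₁ := by simp [epochLen, epochEnd]

lemma epochEnd_add_epochLen (τ₁ m : ℕ) :
    epochEnd τ₁ m + epochLen τ₁ (m + 1) = epochEnd τ₁ (m + 1) := by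
  have : epochEnd τ₁ m ≤ epochEnd τ₁ (m + 1) := epochEnd_mono τ₁ (Nat.le_succ m)
  simp only [epochLen, Nat.add_sub_cancel]; omega

variable {τ₁ : ℕ} (hτ₁ : 2 ≤ τ₁)

include hτ₁

lemma lt_epochEnd (m : ℕ) : m < epochEnd τ₁ (m + 1) := by
  rw [epochEnd_succ]
  calc m < 2 ^ m := Nat.lt_two_pow_self
    _ ≤ τ₁ * 2 ^ m := Nat.le_mul_of_pos_left _ (by omega)

lemma two_le_epochLen (m : ℕ) : 2 ≤ epochLen τ₁ (m + 1) := by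
  cases m with
  | zero => rwa [epochLen_one]
  | succ m =>
    rw [epochLen_succ_succ, epochEnd_succ]
    exact hτ₁.trans (Nat.le_mul_of_pos_right _ (by positivity))

lemma exists_epoch (t : ℕ) : ∃ m, t ≤ epochEnd τ₁ m := ⟨t + 1, (lt_epochEnd hτ₁ t).le⟩

end Epochs

/-! ### Processes with prescribed conditional laws: disintegration, i.i.d. blocks, Azuma–Hoeffding
-/

section ConditionalLaws

variable {Ω O : Type*} [MeasurableSpace Ω] [MeasurableSpace O]

/-- The process `Z 1, Z 2, …` has, for every `t ≥ 1`, the conditional law `κ t` given its past,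
where `κ t` is a function of the path that depends on the coordinates `1, …, t - 1` only. -/
structure HasStepLaws (P : Measure Ω) (Z : ℕ → Ω → O) (κ : ℕ → (ℕ → O) → Measure O) : Prop where
  measurable : ∀ t, Measurable (Z t)
  measurable_law : ∀ t, Measurable (κ t)
  isProbabilityMeasure : ∀ t z, IsProbabilityMeasure (κ t z)
  congr_past : ∀ t z z', (∀ s ∈ Finset.Icc 1 (t - 1), z s = z' s) → κ t z = κ t z'
  condLaw : ∀ t, 1 ≤ t → ∀ U : Set O, MeasurableSet U →
    P⟦Z t ⁻¹' U | ⨆ s ∈ Finset.Icc 1 (t - 1), MeasurableSpace.comap (Z s) inferInstance⟧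
      =ᵐ[P] fun ω => (κ t (fun s => Z s ω)).real U

/-- The path `z` with all coordinates outside `1, …, s` replaced by `o`. -/
def truncPath (o : O) (s : ℕ) (z : ℕ → O) : ℕ → O :=
  fun k => if k ∈ Finset.Icc 1 s then z k else o

omit [MeasurableSpace O] in
lemma truncPath_eq (o : O) {s : ℕ} (z : ℕ → O) {k : ℕ} (hk : k ∈ Finset.Icc 1 s) :
    truncPath o s z k = z k := if_pos hk

lemma measurable_truncPath (o : O) (s : ℕ) : Measurable (truncPath o s) := by
  refine measurable_pi_lambda _ fun k => ?_
  unfold truncPath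
  split_ifs
  · exact measurable_pi_apply k
  · exact measurable_const

-- Truncation gives a full path, at which κ can be evaluated, that is still measurable for the past.
-- The bound is written `s + 1 - 1` to match `condLaw` at round `s + 1`.
omit [MeasurableSpace Ω] in
lemma measurable_truncPath_of_past (Z : ℕ → Ω → O) (o : O) (s : ℕ) :
    Measurable[⨆ k ∈ Finset.Icc 1 (s + 1 - 1), MeasurableSpace.comap (Z k) inferInstance]
      fun ω => truncPath o s (fun k => Z k ω) := by
  refine @measurable_pi_lambda _ _ _ (_) _ _ fun k => ?_
  by_cases hk : k ∈ Finset.Icc 1 s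
  · have h1 : (fun ω => truncPath o s (fun k => Z k ω) k) = Z k := by
      funext ω; exact truncPath_eq o _ hk
    rw [h1]
    refine Measurable.mono (comap_measurable (Z k)) ?_ le_rfl
    exact le_iSup₂_of_le k (by simpa using hk) le_rfl
  · have h1 : (fun ω => truncPath o s (fun k => Z k ω) k) = fun _ => o := by
      funext ω; exact if_neg hk
    rw [h1]
    exact measurable_const

variable {P : Measure Ω} [IsProbabilityMeasure P] {Z : ℕ → Ω → O}
  {κ : ℕ → (ℕ → O) → Measure O}

omit [IsProbabilityMeasure P] in
lemma HasStepLaws.measurable_path (h : HasStepLaws P Z κ) :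
    Measurable fun ω => fun s => Z s ω :=
  measurable_pi_lambda _ h.measurable

/-- Finite measures on a product are determined by rectangles V × U. On a rectangle the identity is
the defining property of the conditional probability of U, integrated over the past event V;
truncating the path does not change κ. -/
lemma HasStepLaws.map_eq_compProd (h : HasStepLaws P Z κ) (o : O) (s : ℕ) :
    P.map (fun ω => (truncPath o s (fun k => Z k ω), Z (s + 1) ω)) =
      (P.map fun ω => truncPath o s (fun k => Z k ω)) ⊗ₘ
        (⟨κ (s + 1), h.measurable_law _⟩ : Kernel (ℕ → O) O) := by
  have hZ := h.measurable_path
  have hT : Measurable fun ω => truncPath o s (fun k => Z k ω) := (measurable_truncPath o s).comp hZ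
  have hprob := h.isProbabilityMeasure
  have : IsMarkovKernel (⟨κ (s + 1), h.measurable_law _⟩ : Kernel (ℕ → O) O) :=
    ⟨fun z => hprob (s + 1) z⟩
  have : IsProbabilityMeasure (P.map fun ω => truncPath o s (fun k => Z k ω)) :=
    Measure.isProbabilityMeasure_map hT.aemeasurable
  have hpair := hT.prodMk (h.measurable (s + 1))
  have : IsProbabilityMeasure
      (P.map (fun ω => (truncPath o s (fun k => Z k ω), Z (s + 1) ω))) :=
    Measure.isProbabilityMeasure_map hpair.aemeasurable
  refine Measure.ext_prod fun {V U} hV hU => ?_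
  rw [Measure.map_apply hpair (hV.prod hU), Measure.compProd_apply_prod hV hU,
    setLIntegral_map hV (Kernel.measurable_coe _ hU) hT]
  have hmle : (⨆ k ∈ Finset.Icc 1 (s + 1 - 1), MeasurableSpace.comap (Z k) inferInstance) ≤
      ‹MeasurableSpace Ω› := iSup₂_le fun k _ => (h.measurable k).comap_le
  have hV' := measurable_truncPath_of_past Z o s hV
  have hUm : MeasurableSet (Z (s + 1) ⁻¹' U) := h.measurable _ hU
  have hint : Integrable ((Z (s + 1) ⁻¹' U).indicator fun _ => (1 : ℝ)) P :=
    (integrable_const _).indicator hUm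
  have e1 := setIntegral_condExp hmle hint hV'
  rw [setIntegral_congr_ae (hmle _ hV')
    ((h.condLaw (s + 1) (by omega) U hU).mono fun ω hω _ => hω)] at e1
  rw [← Pi.one_def, integral_indicator_one hUm] at e1
  have e2 : ∀ ω, κ (s + 1) (truncPath o s fun k => Z k ω) = κ (s + 1) (fun k => Z k ω) :=
    fun ω => h.congr_past _ _ _ fun k hk => truncPath_eq o _ (by simpa using hk)
  have e3 : ∫⁻ ω in (fun ω => truncPath o s (fun k => Z k ω)) ⁻¹' V,
      κ (s + 1) (fun k => Z k ω) U ∂P = ENNReal.ofReal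
        (∫ ω in (fun ω => truncPath o s (fun k => Z k ω)) ⁻¹' V,
          (κ (s + 1) (fun k => Z k ω)).real U ∂P) := by
    have hmeas : Measurable fun ω => κ (s + 1) (fun k => Z k ω) U :=
      (Measure.measurable_coe hU).comp ((h.measurable_law _).comp hZ)
    rw [ofReal_integral_eq_lintegral_ofReal]
    · refine lintegral_congr fun ω => ?_
      rw [ofReal_measureReal]
    · refine Integrable.of_mem_Icc 0 1 hmeas.ennreal_toReal.aemeasurable ?_
      exact Filter.Eventually.of_forall fun ω => ⟨measureReal_nonneg, measureReal_le_one⟩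
    · exact Filter.Eventually.of_forall fun ω => measureReal_nonneg
  simp only [Kernel.coe_mk, e2]
  rw [e3, e1, measureReal_restrict_apply hUm, ofReal_measureReal]
  congr 1
  ext ω
  simp [and_comm]

/-- Conditioning on the past: the next observation may be integrated out. -/
theorem HasStepLaws.lintegral_step (h : HasStepLaws P Z κ) (s : ℕ) {φ : (ℕ → O) × O → ℝ≥0∞}
    (hφ : Measurable φ)
    (hdep : ∀ z z' o, (∀ k ∈ Finset.Icc 1 s, z k = z' k) → φ (z, o) = φ (z', o)) :
    ∫⁻ ω, φ (fun k => Z k ω, Z (s + 1) ω) ∂P =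
      ∫⁻ ω, ∫⁻ o, φ (fun k => Z k ω, o) ∂κ (s + 1) (fun k => Z k ω) ∂P := by
  -- Truncated paths need a filler value; any observed value will do.
  obtain ⟨ω₀⟩ : Nonempty Ω := P.nonempty_of_neZero
  set o := Z 0 ω₀
  have hT : Measurable fun ω => truncPath o s (fun k => Z k ω) :=
    (measurable_truncPath o s).comp h.measurable_path
  have hprob := h.isProbabilityMeasure
  have : IsMarkovKernel (⟨κ (s + 1), h.measurable_law _⟩ : Kernel (ℕ → O) O) :=
    ⟨fun z => hprob (s + 1) z⟩
  have key := congrArg (fun μ => ∫⁻ q, φ q ∂μ) (h.map_eq_compProd o s)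
  rw [lintegral_map hφ (hT.prodMk (h.measurable _)), Measure.lintegral_compProd hφ,
    lintegral_map (Measurable.lintegral_kernel_prod_right' hφ) hT] at key
  have d : ∀ ω o', φ (truncPath o s fun k => Z k ω, o') = φ (fun k => Z k ω, o') :=
    fun ω o' => hdep _ _ _ fun k hk => truncPath_eq o _ hk
  have e2 : ∀ ω, κ (s + 1) (truncPath o s fun k => Z k ω) = κ (s + 1) (fun k => Z k ω) :=
    fun ω => h.congr_past _ _ _ fun k hk => truncPath_eq o _ (by simpa using hk)
  simpa only [d, Kernel.coe_mk, e2] using key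

/-- If the conditional law stays the same during a block of rounds, then the observations of the
block are independent and identically distributed, given the past. -/
theorem HasStepLaws.lintegral_block (h : HasStepLaws P Z κ) {T n : ℕ}
    {κ₀ : (ℕ → O) → Measure O} (hκ : ∀ t z, T < t → t ≤ T + n → κ t z = κ₀ z) :
    ∀ k ≤ n, ∀ {φ : (ℕ → O) × (Fin k → O) → ℝ≥0∞}, Measurable φ →
    (∀ z z' S, (∀ k ∈ Finset.Icc 1 T, z k = z' k) → φ (z, S) = φ (z', S)) →
    ∫⁻ ω, φ (fun k => Z k ω, fun j => Z (T + 1 + j) ω) ∂P =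
      ∫⁻ ω, ∫⁻ S, φ (fun k => Z k ω, S) ∂Measure.pi (fun _ : Fin k => κ₀ (fun k => Z k ω)) ∂P := by
  intro k
  induction k with
  | zero =>
    intro _ φ hφ hdep
    refine lintegral_congr fun ω => ?_
    rw [Measure.pi_of_empty _, lintegral_dirac' _ (f := fun S => φ (fun k => Z k ω, S))
      (hφ.comp measurable_prodMk_left)]
    congr 2
    exact Subsingleton.elim _ _
  | succ k ih =>
    intro hk φ hφ hdep
    have hκ' : ∀ z, κ (T + k + 1) z = κ₀ z := fun z => hκ _ z (by omega) (by omega)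
    have hprob : ∀ z, IsProbabilityMeasure (κ₀ z) := fun z => by
      rw [← hκ' z]; exact h.isProbabilityMeasure _ z
    have hmκ : Measurable κ₀ := by
      have : κ₀ = κ (T + k + 1) := funext fun z => (hκ' z).symm
      rw [this]; exact h.measurable_law _
    have hpast : ∀ z z', (∀ j ∈ Finset.Icc 1 T, z j = z' j) → κ₀ z = κ₀ z' := fun z z' hz => by
      rw [← hκ (T + 1) z (by omega) (by omega), ← hκ (T + 1) z' (by omega) (by omega)]
      exact h.congr_past _ _ _ (by simpa using hz)
    -- The last observation of the block is split off and integrated out by `lintegral_step`; the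
    -- induction hypothesis handles the remaining integrand, and Tonelli reassembles the product
    -- measure.
    let e := MeasurableEquiv.piFinSuccAbove (fun _ : Fin (k + 1) => O) (Fin.last k)
    let K : Kernel (ℕ → O) O := ⟨κ₀, hmκ⟩
    have : IsMarkovKernel K := ⟨hprob⟩
    have hsplit : ∀ ω, e.symm (Z (T + k + 1) ω, fun j : Fin k => Z (T + 1 + j) ω) =
        fun j : Fin (k + 1) => Z (T + 1 + j) ω := by
      intro ω
      rw [MeasurableEquiv.symm_apply_eq]
      refine Prod.ext ?_ ?_
      · simp [e, MeasurableEquiv.piFinSuccAbove, Fin.insertNthEquiv, add_right_comm]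
      · funext j
        simp [e, MeasurableEquiv.piFinSuccAbove, Fin.insertNthEquiv, Fin.init]
    have hφ' : Measurable fun q : (ℕ → O) × O =>
        φ (q.1, e.symm (q.2, fun j : Fin k => q.1 (T + 1 + j))) := by
      refine hφ.comp (measurable_fst.prodMk (e.symm.measurable.comp
        (measurable_snd.prodMk (measurable_pi_lambda _ fun j => ?_))))
      exact (measurable_pi_apply _).comp measurable_fst
    have step := h.lintegral_step (T + k) hφ' (fun z z' o hz => by
      have h1 : (fun j : Fin k => z (T + 1 + j)) = fun j : Fin k => z' (T + 1 + j) :=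
        funext fun j => hz _ (Finset.mem_Icc.2 ⟨by omega, by omega⟩)
      rw [h1]
      exact hdep _ _ _ fun i hi => hz i
        (Finset.mem_Icc.2 ⟨(Finset.mem_Icc.1 hi).1, (Finset.mem_Icc.1 hi).2.trans (by omega)⟩))
    simp only [hsplit, hκ'] at step
    rw [step]
    have hψ' : Measurable fun q : ((ℕ → O) × (Fin k → O)) × O =>
        φ (q.1.1, e.symm (q.2, q.1.2)) :=
      hφ.comp ((measurable_fst.comp measurable_fst).prodMk (e.symm.measurable.comp
        (measurable_snd.prodMk (measurable_snd.comp measurable_fst))))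
    have hψ : Measurable fun q : (ℕ → O) × (Fin k → O) =>
        ∫⁻ o, φ (q.1, e.symm (o, q.2)) ∂κ₀ q.1 := by
      have := Measurable.lintegral_kernel_prod_right' (κ := K.comap Prod.fst measurable_fst) hψ'
      simpa [K] using this
    have ihk := ih (by omega) hψ (fun z z' S hz => by
      simp only [hpast z z' hz, hdep z z' _ hz])
    simp only at ihk
    rw [ihk]
    refine lintegral_congr fun ω => ?_
    set w : ℕ → O := fun k => Z k ω
    have := hprob w
    have hφw : Measurable fun S => φ (w, S) := hφ.comp measurable_prodMk_left
    have hp := (measurePreserving_piFinSuccAbove (fun _ : Fin (k + 1) => κ₀ w) (Fin.last k)).symm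
    rw [← hp.lintegral_comp hφw]
    exact (lintegral_prod_symm' _ (hφw.comp e.symm.measurable)).symm

/-- The exponential moments of a sum of bounded conditionally centred variables. -/
theorem HasStepLaws.lintegral_exp_le (h : HasStepLaws P Z κ) {Y : O → ℝ} (hY : Measurable Y)
    (hY01 : ∀ o, Y o ∈ Set.Icc (0 : ℝ) 1) (l : ℝ) (t : ℕ) :
    ∫⁻ ω, ENNReal.ofReal (Real.exp (l * ∑ s ∈ Finset.Icc 1 t,
      (Y (Z s ω) - ∫ o, Y o ∂κ s (fun k => Z k ω)))) ∂P ≤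
      ENNReal.ofReal (Real.exp (l ^ 2 * t / 8)) := by
  have hmean : ∀ s, Measurable fun z => ∫ o, Y o ∂κ s z := fun s => by
    let K : Kernel (ℕ → O) O := ⟨κ s, h.measurable_law s⟩
    exact (hY.stronglyMeasurable.integral_kernel (κ := K)).measurable
  induction t with
  | zero => simp
  | succ t ih =>
    let A : (ℕ → O) → ℝ := fun z => ∑ s ∈ Finset.Icc 1 t, (Y (z s) - ∫ o, Y o ∂κ s z)
    have hA : Measurable A := Finset.measurable_sum _ fun s _ =>
      (hY.comp (measurable_pi_apply s)).sub (hmean s)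
    have hAdep : ∀ z z' : ℕ → O, (∀ k ∈ Finset.Icc 1 t, z k = z' k) → A z = A z' :=
      fun z z' hz => Finset.sum_congr rfl fun s hs => by
        rw [hz s hs, h.congr_past s z z' fun k hk => hz k (by
          simp only [Finset.mem_Icc] at hk hs ⊢; omega)]
    let φ : (ℕ → O) × O → ℝ≥0∞ := fun q => ENNReal.ofReal (Real.exp (l * A q.1)) *
      ENNReal.ofReal (Real.exp (l * (Y q.2 - ∫ o, Y o ∂κ (t + 1) q.1)))
    have hφ : Measurable φ := by
      have h1 : Measurable fun q : (ℕ → O) × O => l * A q.1 :=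
        (hA.comp measurable_fst).const_mul l
      have h2 : Measurable fun q : (ℕ → O) × O => l * (Y q.2 - ∫ o, Y o ∂κ (t + 1) q.1) :=
        ((hY.comp measurable_snd).sub ((hmean _).comp measurable_fst)).const_mul l
      exact h1.exp.ennreal_ofReal.mul h2.exp.ennreal_ofReal
    have step := h.lintegral_step t hφ (fun z z' o hz => by
      simp only [φ]
      rw [hAdep z z' hz, h.congr_past (t + 1) z z' (by simpa using hz)])
    have e1 : ∀ ω, ENNReal.ofReal (Real.exp (l * ∑ s ∈ Finset.Icc 1 (t + 1),
        (Y (Z s ω) - ∫ o, Y o ∂κ s (fun k => Z k ω)))) = φ (fun k => Z k ω, Z (t + 1) ω) := by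
      intro ω
      rw [Finset.sum_Icc_succ_top (by omega), mul_add, Real.exp_add,
        ENNReal.ofReal_mul (Real.exp_nonneg _)]
    simp only [e1]
    rw [step]
    have inner : ∀ z, ∫⁻ o, ENNReal.ofReal (Real.exp (l * (Y o - ∫ o, Y o ∂κ (t + 1) z)))
        ∂κ (t + 1) z ≤ ENNReal.ofReal (Real.exp (l ^ 2 / 8)) := by
      intro z
      have := h.isProbabilityMeasure (t + 1) z
      -- Hoeffding's lemma: a variable with values in [0,1] has variance proxy 1/4, hence the factor
      -- exp(l² / 8).
      have hs := hasSubgaussianMGF_of_mem_Icc (μ := κ (t + 1) z) hY.aemeasurable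
        (Filter.Eventually.of_forall hY01)
      have h2 := hs.mgf_le l
      rw [mgf] at h2
      rw [← ofReal_integral_eq_lintegral_ofReal (hs.integrable_exp_mul l)
        (Filter.Eventually.of_forall fun _ => Real.exp_nonneg _)]
      refine ENNReal.ofReal_le_ofReal (h2.trans (Real.exp_le_exp.2 (le_of_eq ?_)))
      simp
      ring
    calc ∫⁻ ω, ∫⁻ o, φ (fun k => Z k ω, o) ∂κ (t + 1) (fun k => Z k ω) ∂P
        ≤ ∫⁻ ω, ENNReal.ofReal (Real.exp (l * A (fun k => Z k ω))) *
            ENNReal.ofReal (Real.exp (l ^ 2 / 8)) ∂P := by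
          refine lintegral_mono fun ω => ?_
          simp only [φ]
          rw [lintegral_const_mul _ (((hY.sub_const _).const_mul l).exp.ennreal_ofReal)]
          gcongr
          exact inner _
      _ ≤ ENNReal.ofReal (Real.exp (l ^ 2 * t / 8)) * ENNReal.ofReal (Real.exp (l ^ 2 / 8)) := by
          have h1 : Measurable fun ω => l * A (fun k => Z k ω) :=
            (hA.comp h.measurable_path).const_mul l
          rw [lintegral_mul_const _ h1.exp.ennreal_ofReal]
          gcongr
      _ = ENNReal.ofReal (Real.exp (l ^ 2 * (t + 1 : ℕ) / 8)) := by
          rw [← ENNReal.ofReal_mul (Real.exp_nonneg _), ← Real.exp_add]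
          congr 2
          push_cast
          ring

/-- The Azuma–Hoeffding inequality. -/
theorem HasStepLaws.measure_sum_gt_le (h : HasStepLaws P Z κ) {Y : O → ℝ} (hY : Measurable Y)
    (hY01 : ∀ o, Y o ∈ Set.Icc (0 : ℝ) 1) {t : ℕ} (ht : 1 ≤ t) {L : ℝ} (hL : 0 ≤ L) :
    P {ω | √(t * L / 2) < ∑ s ∈ Finset.Icc 1 t,
      (Y (Z s ω) - ∫ o, Y o ∂κ s (fun k => Z k ω))} ≤ ENNReal.ofReal (Real.exp (-L)) := by
  have hmean : ∀ s, Measurable fun ω => ∫ o, Y o ∂κ s (fun k => Z k ω) := fun s => by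
    let K : Kernel (ℕ → O) O := ⟨κ s, h.measurable_law s⟩
    exact (hY.stronglyMeasurable.integral_kernel (κ := K)).measurable.comp h.measurable_path
  have hS : Measurable fun ω => ∑ s ∈ Finset.Icc 1 t,
      (Y (Z s ω) - ∫ o, Y o ∂κ s (fun k => Z k ω)) :=
    Finset.measurable_sum _ fun s _ => (hY.comp (h.measurable s)).sub (hmean s)
  have ht0 : (0 : ℝ) < t := by exact_mod_cast ht
  set a := √(t * L / 2) with ha
  have ha0 : 0 ≤ a := Real.sqrt_nonneg _
  have ha2 : a ^ 2 = t * L / 2 := Real.sq_sqrt (by positivity)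
  -- This l minimizes l² t / 8 - l a. With a² = t L / 2 it gives l a = 2L and l² t / 8 = L, so
  -- Markov's inequality leaves exp(-L).
  set l := 4 * a / t with hl
  have hl0 : 0 ≤ l := by positivity
  have hm := h.lintegral_exp_le hY hY01 l t
  have hmarkov := mul_meas_ge_le_lintegral₀ (μ := P)
    ((hS.const_mul l).exp.ennreal_ofReal).aemeasurable (ENNReal.ofReal (Real.exp (l * a)))
  have hle : ENNReal.ofReal (Real.exp (l * a)) * P {ω | a < ∑ s ∈ Finset.Icc 1 t,
      (Y (Z s ω) - ∫ o, Y o ∂κ s (fun k => Z k ω))} ≤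
      ENNReal.ofReal (Real.exp (l ^ 2 * t / 8)) := by
    refine le_trans ?_ (hmarkov.trans hm)
    refine mul_le_mul_right (measure_mono fun ω hω => ?_) _
    refine ENNReal.ofReal_le_ofReal (Real.exp_le_exp.2 ?_)
    exact mul_le_mul_of_nonneg_left (le_of_lt hω) hl0
  have e1 : l * a = 2 * L := by
    rw [hl]; field_simp; rw [ha2]; ring
  have e2 : l ^ 2 * t / 8 = L := by
    rw [hl]; field_simp; rw [ha2]; ring
  rw [e1, e2] at hle
  have e3 : ENNReal.ofReal (Real.exp (-L)) * ENNReal.ofReal (Real.exp (2 * L)) =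
      ENNReal.ofReal (Real.exp L) := by
    rw [← ENNReal.ofReal_mul (Real.exp_nonneg _), ← Real.exp_add]
    congr 2; ring
  rw [← e3, mul_comm] at hle
  exact (ENNReal.mul_le_mul_iff_left (by simp [Real.exp_pos]) ENNReal.ofReal_ne_top).1 hle

end ConditionalLaws

/-! ### Deterministic analysis of inverse gap weighting -/

section InverseGapWeighting

variable {X A : Type*} [MeasurableSpace X] [Fintype A] [MeasurableSpace A]

/-- The gap `f(x, â) - f(x, a)` of the arm `a`, where `â` maximizes `f(x, ·)`. -/
def gap (am : ArgmaxRule A) (f : Model X A) (x : X) (a : A) : ℝ :=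
  f.toFun x (am.pick (f.toFun x)) - f.toFun x a

omit [Fintype A] in
lemma gap_nonneg (am : ArgmaxRule A) (f : Model X A) (x : X) (a : A) : 0 ≤ gap am f x a :=
  sub_nonneg.2 (am.le_pick _ a)

omit [Fintype A] in
lemma gap_le_one (am : ArgmaxRule A) (f : Model X A) (x : X) (a : A) : gap am f x a ≤ 1 := by
  have h1 := (f.mem_Icc x (am.pick (f.toFun x))).2
  have h2 := (f.mem_Icc x a).1
  simp only [gap]; linarith

omit [Fintype A] in
lemma measurable_pick [MeasurableSingletonClass A] (am : ArgmaxRule A) (f : Model X A) :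
    Measurable fun x => am.pick (f.toFun x) :=
  am.measurable_pick.comp (measurable_pi_iff.2 f.measurable_toFun)

lemma measurable_gap [MeasurableSingletonClass A] (am : ArgmaxRule A) (f : Model X A) (a : A) :
    Measurable fun x => gap am f x a := by
  classical
  refine Measurable.sub ?_ (f.measurable_toFun a)
  have key : (fun x => f.toFun x (am.pick (f.toFun x))) = fun x => ∑ b : A,
      Set.indicator {x | am.pick (f.toFun x) = b} (fun x => f.toFun x b) x := by
    funext x
    rw [Finset.sum_eq_single (am.pick (f.toFun x))]
    · simp
    · intro b _ hb
      exact Set.indicator_of_notMem (fun h => hb h.symm) _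
    · intro h
      exact absurd (Finset.mem_univ _) h
  rw [key]
  exact Finset.measurable_sum _ fun b _ => (f.measurable_toFun b).indicator
    (measurable_pick am f (measurableSet_singleton b))

/-- The kernel that plays the arm `â` that maximizes `f(x, ·)`. -/
noncomputable def greedy [MeasurableSingletonClass A] (am : ArgmaxRule A) (f : Model X A) :
    ProbKernel X A where
  prob x a := Set.indicator {x | am.pick (f.toFun x) = a} (fun _ => (1 : ℝ)) x
  measurable_prob a := measurable_const.indicator (measurable_pick am f (measurableSet_singleton a))
  nonneg x a := Set.indicator_nonneg (fun _ _ => zero_le_one) _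
  sum_eq_one x := by
    classical
    simp [Set.indicator_apply]

lemma sum_greedy_mul [MeasurableSingletonClass A] (am : ArgmaxRule A) (f : Model X A) (x : X)
    (u : A → ℝ) : ∑ a, (greedy am f).prob x a * u a = u (am.pick (f.toFun x)) := by
  classical
  simp [greedy, Set.indicator_apply]

omit [MeasurableSpace A] in
lemma integrable_sum_prob_mul (D : Measure (X × (A → ℝ))) [IsProbabilityMeasure D]
    (q : ProbKernel X A) {g : X → A → ℝ} (hg : ∀ a, Measurable fun x => g x a)
    (hg1 : ∀ x a, g x a ∈ Set.Icc (0 : ℝ) 1) :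
    Integrable (fun x => ∑ a, q.prob x a * g x a) (D.map Prod.fst) := by
  have := Measure.isProbabilityMeasure_map (μ := D) (measurable_fst (α := X)).aemeasurable
  refine Integrable.of_mem_Icc 0 1 (Finset.measurable_sum _ fun a _ =>
    (q.measurable_prob a).mul (hg a)).aemeasurable (Filter.Eventually.of_forall fun x => ⟨?_, ?_⟩)
  · exact Finset.sum_nonneg fun a _ => mul_nonneg (q.nonneg x a) (hg1 x a).1
  · rw [← q.sum_eq_one x]
    exact Finset.sum_le_sum fun a _ => mul_le_of_le_one_right (q.nonneg x a) (hg1 x a).2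

/-- The expected gap of the arms that are chosen by the kernel `q`. -/
noncomputable def expGap (D : Measure (X × (A → ℝ))) (am : ArgmaxRule A) (f : Model X A)
    (q : ProbKernel X A) : ℝ :=
  ∫ x, ∑ a, q.prob x a * gap am f x a ∂(D.map Prod.fst)

/-- The expected absolute difference of two models under the kernel `q`. -/
noncomputable def absErr (D : Measure (X × (A → ℝ))) (f g : Model X A) (q : ProbKernel X A) : ℝ :=
  ∫ x, ∑ a, q.prob x a * |f.toFun x a - g.toFun x a| ∂(D.map Prod.fst)

omit [Fintype A] [MeasurableSpace A] in
lemma abs_model_sub_mem_Icc (f g : Model X A) (x : X) (a : A) :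
    |f.toFun x a - g.toFun x a| ∈ Set.Icc (0 : ℝ) 1 := by
  have h1 := f.mem_Icc x a
  have h2 := g.mem_Icc x a
  exact ⟨abs_nonneg _, abs_le.2 ⟨by linarith [h1.1, h2.2], by linarith [h1.2, h2.1]⟩⟩

omit [Fintype A] [MeasurableSpace A] in
lemma measurable_abs_model_sub (f g : Model X A) (a : A) :
    Measurable fun x => |f.toFun x a - g.toFun x a| :=
  ((f.measurable_toFun a).sub (g.measurable_toFun a)).abs

omit [MeasurableSpace A] in
lemma absErr_comm (D : Measure (X × (A → ℝ))) (f g : Model X A) (q : ProbKernel X A) :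
    absErr D f g q = absErr D g f q := by
  simp only [absErr, abs_sub_comm]

variable [MeasurableSingletonClass A] (D : Measure (X × (A → ℝ))) [IsProbabilityMeasure D]
  (am : ArgmaxRule A)

lemma integrable_expGap (f : Model X A) (q : ProbKernel X A) :
    Integrable (fun x => ∑ a, q.prob x a * gap am f x a) (D.map Prod.fst) :=
  integrable_sum_prob_mul D q (measurable_gap am f) fun x a =>
    ⟨gap_nonneg am f x a, gap_le_one am f x a⟩

omit [IsProbabilityMeasure D] [MeasurableSingletonClass A] in
lemma expGap_nonneg (f : Model X A) (q : ProbKernel X A) : 0 ≤ expGap D am f q :=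
  integral_nonneg fun x => Finset.sum_nonneg fun a _ =>
    mul_nonneg (q.nonneg x a) (gap_nonneg am f x a)

lemma expGap_le_one (f : Model X A) (q : ProbKernel X A) : expGap D am f q ≤ 1 := by
  have := Measure.isProbabilityMeasure_map (μ := D) (measurable_fst (α := X)).aemeasurable
  have h : expGap D am f q ≤ ∫ _, (1 : ℝ) ∂(D.map Prod.fst) := by
    refine integral_mono (integrable_expGap D am f q) (integrable_const _) fun x => ?_
    simp only
    rw [← q.sum_eq_one x]
    exact Finset.sum_le_sum fun a _ =>
      mul_le_of_le_one_right (q.nonneg x a) (gap_le_one am f x a)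
  simpa using h

omit [IsProbabilityMeasure D] in
lemma expGap_greedy (f : Model X A) : expGap D am f (greedy am f) = 0 := by
  simp [expGap, sum_greedy_mul, gap]

/-- Replacing f by g costs the error at the arm greedy for f and the error at the arm played; after
the replacement, the value under g of the arm greedy for f is at most the maximum of g. -/
lemma expGap_le_add_absErr (f g : Model X A) (q : ProbKernel X A) :
    expGap D am f q ≤ expGap D am g q + absErr D f g (greedy am f) + absErr D f g q := by
  have i1 := integrable_expGap D am g q
  have i2 : ∀ q : ProbKernel X A, Integrable (fun x => ∑ a, q.prob x a *
      |f.toFun x a - g.toFun x a|) (D.map Prod.fst) := fun q =>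
    integrable_sum_prob_mul D q (measurable_abs_model_sub f g) (abs_model_sub_mem_Icc f g)
  have e : expGap D am g q + absErr D f g (greedy am f) + absErr D f g q =
      ∫ x, ((∑ a, q.prob x a * gap am g x a + ∑ a, (greedy am f).prob x a *
        |f.toFun x a - g.toFun x a|) + ∑ a, q.prob x a * |f.toFun x a - g.toFun x a|)
        ∂(D.map Prod.fst) := by
    have i3 : Integrable (fun x => ∑ a, q.prob x a * gap am g x a + ∑ a,
        (greedy am f).prob x a * |f.toFun x a - g.toFun x a|) (D.map Prod.fst) := i1.add (i2 _)
    rw [integral_add i3 (i2 q), integral_add i1 (i2 _)]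
    rfl
  rw [e]
  refine integral_mono (integrable_expGap D am f q) ((i1.add (i2 _)).add (i2 q)) fun x => ?_
  simp only
  rw [sum_greedy_mul am f x fun a => |f.toFun x a - g.toFun x a|]
  set b := am.pick (f.toFun x)
  -- Spreading the greedy term over q makes the inequality an armwise one.
  have e2 : |f.toFun x b - g.toFun x b| = ∑ a, q.prob x a * |f.toFun x b - g.toFun x b| := by
    rw [← Finset.sum_mul, q.sum_eq_one, one_mul]
  rw [e2, ← Finset.sum_add_distrib, ← Finset.sum_add_distrib]
  refine Finset.sum_le_sum fun a _ => ?_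
  rw [← mul_add, ← mul_add]
  refine mul_le_mul_of_nonneg_left ?_ (q.nonneg x a)
  have h1 := le_abs_self (f.toFun x b - g.toFun x b)
  have h2 := neg_abs_le (f.toFun x a - g.toFun x a)
  have h3 := am.le_pick (g.toFun x) b
  simp only [gap]
  linarith

omit [MeasurableSingletonClass A] in
lemma igwProb_of_ne (γ : ℝ≥0) (f : Model X A) (x : X) {a : A}
    (ha : a ≠ am.pick (f.toFun x)) :
    igwProb am γ f x a = 1 / ((Fintype.card A : ℝ) + γ * gap am f x a) :=
  if_neg ha

/-- Equality holds off the greedy arm. The greedy arm has gap zero, and it keeps mass at least 1/K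
because each of the other K - 1 arms gets at most 1/K. -/
lemma one_le_igwProb_mul (γ : ℝ≥0) (f : Model X A) (x : X) (a : A) :
    1 ≤ igwProb am γ f x a * ((Fintype.card A : ℝ) + γ * gap am f x a) := by
  classical
  have hK : (0 : ℝ) < Fintype.card A := by exact_mod_cast Fintype.card_pos_iff.2 ⟨a⟩
  have hpos : ∀ b, 0 < (Fintype.card A : ℝ) + γ * gap am f x b := fun b =>
    add_pos_of_pos_of_nonneg hK (mul_nonneg γ.2 (gap_nonneg am f x b))
  by_cases ha : a = am.pick (f.toFun x)
  · have h1 : ∀ b ∈ Finset.univ.erase a, igwProb am γ f x b ≤ 1 / (Fintype.card A : ℝ) := by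
      intro b hb
      rw [igwProb_of_ne am γ f x (ha ▸ Finset.ne_of_mem_erase hb)]
      exact one_div_le_one_div_of_le hK
        (le_add_of_nonneg_right (mul_nonneg γ.2 (gap_nonneg am f x b)))
    have h2 := Finset.sum_le_sum h1
    have h3 := (igwKernel am γ f).sum_eq_one x
    rw [← Finset.add_sum_erase _ _ (Finset.mem_univ a)] at h3
    change igwProb am γ f x a + ∑ b ∈ Finset.univ.erase a, igwProb am γ f x b = 1 at h3
    rw [Finset.sum_const, Finset.card_erase_of_mem (Finset.mem_univ a), Finset.card_univ,
      nsmul_eq_mul, Nat.cast_sub (Fintype.card_pos_iff.2 ⟨a⟩), Nat.cast_one] at h2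
    have h4 : ((Fintype.card A : ℝ) - 1) * (1 / Fintype.card A) = 1 - 1 / Fintype.card A := by
      field_simp
    have h5 : 1 / (Fintype.card A : ℝ) ≤ igwProb am γ f x a := by linarith
    have h6 : gap am f x a = 0 := by rw [gap, ← ha, sub_self]
    rw [h6, mul_zero, add_zero]
    rwa [div_le_iff₀ hK] at h5
  · rw [igwProb_of_ne am γ f x ha, one_div_mul_cancel (hpos a).ne']

/-- Each arm contributes at most 1/γ, since gap / (K + γ gap) ≤ 1/γ. -/
lemma expGap_igwKernel_le {γ : ℝ≥0} (hγ : 0 < γ) (f : Model X A) :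
    expGap D am f (igwKernel am γ f) ≤ Fintype.card A / γ := by
  classical
  have := Measure.isProbabilityMeasure_map (μ := D) (measurable_fst (α := X)).aemeasurable
  have hγ' : (0 : ℝ) < γ := hγ
  have h : expGap D am f (igwKernel am γ f) ≤
      ∫ _, (Fintype.card A / γ : ℝ) ∂(D.map Prod.fst) := by
    refine integral_mono (integrable_expGap D am f _) (integrable_const _) fun x => ?_
    have h1 : ∀ a ∈ Finset.univ, (igwKernel am γ f).prob x a * gap am f x a ≤ 1 / (γ : ℝ) := by
      intro a _
      have hK : (0 : ℝ) < Fintype.card A := by exact_mod_cast Fintype.card_pos_iff.2 ⟨a⟩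
      change igwProb am γ f x a * gap am f x a ≤ _
      by_cases ha : a = am.pick (f.toFun x)
      · have h6 : gap am f x a = 0 := by rw [gap, ← ha, sub_self]
        rw [h6, mul_zero]
        positivity
      · have hg := gap_nonneg am f x a
        rw [igwProb_of_ne am γ f x ha, one_div_mul_eq_div, div_le_div_iff₀ (by positivity) hγ']
        nlinarith
    refine (Finset.sum_le_sum h1).trans (le_of_eq ?_)
    rw [Finset.sum_const, Finset.card_univ, nsmul_eq_mul, mul_one_div]
  simpa using h

/-- The estimation error under an arbitrary kernel, in terms of the risk under the inverse gap
weighting kernel. -/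
lemma absErr_le_of_igwKernel (γ : ℝ≥0) (f fstar g : Model X A) (q : ProbKernel X A)
    {η : ℝ} (hη : 0 < η) :
    absErr D fstar g q ≤ η * (Fintype.card A + γ * expGap D am f q) +
      risk D fstar g (igwKernel am γ f) / (4 * η) := by
  have := Measure.isProbabilityMeasure_map (μ := D) (measurable_fst (α := X)).aemeasurable
  have i1 := integrable_expGap D am f q
  have i2 : Integrable (fun x => ∑ a, (igwKernel am γ f).prob x a *
      (g.toFun x a - fstar.toFun x a) ^ 2) (D.map Prod.fst) := by
    refine integrable_sum_prob_mul D _ (fun a =>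
      ((g.measurable_toFun a).sub (fstar.measurable_toFun a)).pow_const 2) fun x a => ?_
    have h := abs_model_sub_mem_Icc g fstar x a
    rw [← sq_abs]
    exact ⟨by positivity, pow_le_one₀ h.1 h.2⟩
  have e : η * (Fintype.card A + γ * expGap D am f q) +
      risk D fstar g (igwKernel am γ f) / (4 * η) =
      ∫ x, (η * (Fintype.card A + γ * ∑ a, q.prob x a * gap am f x a) +
        (∑ a, (igwKernel am γ f).prob x a * (g.toFun x a - fstar.toFun x a) ^ 2) / (4 * η))
        ∂(D.map Prod.fst) := by
    have i3 : Integrable (fun x => η * ((Fintype.card A : ℝ) +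
        γ * ∑ a, q.prob x a * gap am f x a)) (D.map Prod.fst) :=
      ((integrable_const _).add (i1.const_mul _)).const_mul _
    rw [integral_add i3 (i2.div_const _), integral_const_mul,
      integral_add (integrable_const _) (i1.const_mul _), integral_const_mul, integral_div]
    simp [expGap, risk]
  rw [e]
  refine integral_mono (integrable_sum_prob_mul D q (measurable_abs_model_sub fstar g)
    (abs_model_sub_mem_Icc fstar g)) ((((integrable_const _).add (i1.const_mul _)).const_mul _).add
      (i2.div_const _)) fun x => ?_
  simp only
  have e1 : (Fintype.card A : ℝ) = ∑ a, q.prob x a * (Fintype.card A : ℝ) := by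
    rw [← Finset.sum_mul, q.sum_eq_one, one_mul]
  have e2 : η * (Fintype.card A + γ * ∑ a, q.prob x a * gap am f x a) =
      ∑ a, q.prob x a * (η * (Fintype.card A + γ * gap am f x a)) := by
    conv_lhs => rw [e1]
    rw [Finset.mul_sum, ← Finset.sum_add_distrib, Finset.mul_sum]
    exact Finset.sum_congr rfl fun a _ => by ring
  rw [e2, Finset.sum_div, ← Finset.sum_add_distrib]
  refine Finset.sum_le_sum fun a _ => ?_
  have hp := one_le_igwProb_mul am γ f x a
  have hpn := (igwKernel am γ f).nonneg x a
  have hK : (0 : ℝ) < Fintype.card A := by exact_mod_cast Fintype.card_pos_iff.2 ⟨a⟩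
  have hw : 0 < (Fintype.card A : ℝ) + γ * gap am f x a :=
    add_pos_of_pos_of_nonneg hK (mul_nonneg γ.2 (gap_nonneg am f x a))
  change 0 ≤ igwProb am γ f x a at hpn
  change _ ≤ _ + igwProb am γ f x a * _ / _
  set w := (Fintype.card A : ℝ) + γ * gap am f x a
  set p := igwProb am γ f x a
  rw [← sq_abs (g.toFun x a - fstar.toFun x a), abs_sub_comm (g.toFun x a)]
  set u := |fstar.toFun x a - g.toFun x a|
  have hu : 0 ≤ u := abs_nonneg _
  have hq1 := q.prob_le_one x a
  have hq0 := q.nonneg x a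
  -- By AM-GM, u ≤ η w + u² / (4 η w), and p ≥ 1/w.
  have main : u ≤ η * w + p * u ^ 2 / (4 * η) := by
    rw [← sub_le_iff_le_add', le_div_iff₀ (by positivity)]
    by_contra hcon
    rw [not_le] at hcon
    have h1 : p * u ^ 2 * w < (u - η * w) * (4 * η) * w := mul_lt_mul_of_pos_right hcon hw
    have h2 : u ^ 2 ≤ p * w * u ^ 2 := le_mul_of_one_le_left (by positivity) hp
    nlinarith [sq_nonneg (u - 2 * η * w)]
  calc q.prob x a * u ≤ q.prob x a * (η * w + p * u ^ 2 / (4 * η)) :=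
        mul_le_mul_of_nonneg_left main hq0
    _ ≤ q.prob x a * (η * w) + p * u ^ 2 / (4 * η) := by
        rw [mul_add]
        have : 0 ≤ p * u ^ 2 / (4 * η) := by positivity
        nlinarith

/-- One epoch of the analysis of inverse gap weighting: closeness of the regret with respect to
the estimated model and the true regret, for all kernels, is transported to the next epoch. -/
theorem expGap_comparison_step {γ : ℝ≥0} (hγ : 0 < γ) {fstar f g : Model X A} {ε ξ : ℝ}
    (hε : ∀ q, expGap D am f q ≤ 2 * expGap D am fstar q + ε)
    (hξ : risk D fstar g (igwKernel am γ f) ≤ ξ) (q : ProbKernel X A) :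
    expGap D am fstar q ≤ 2 * expGap D am g q +
        (Fintype.card A / γ / 3 + 16 / 3 * (ξ * γ) + ε / 3) ∧
      expGap D am g q ≤ 2 * expGap D am fstar q +
        (Fintype.card A / γ / 3 + 16 / 3 * (ξ * γ) + ε / 3) := by
  have hγ' : (0 : ℝ) < γ := hγ
  have herr : ∀ q, absErr D fstar g q ≤ Fintype.card A / γ / 8 + 2 * (ξ * γ) + ε / 8 +
      expGap D am fstar q / 4 := by
    intro q
    -- With this η the gap of f enters with weight 1/8, so the gap of fstar enters with weight 1/4
    -- after `hε`. Two such errors still leave room to absorb it on the left.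
    have h := absErr_le_of_igwKernel D am γ f fstar g q (η := 1 / (8 * γ)) (by positivity)
    have e : 1 / (8 * (γ : ℝ)) * (Fintype.card A + γ * expGap D am f q) +
        risk D fstar g (igwKernel am γ f) / (4 * (1 / (8 * γ))) =
        Fintype.card A / γ / 8 + expGap D am f q / 8 +
          2 * (risk D fstar g (igwKernel am γ f) * γ) := by
      field_simp
      ring
    rw [e] at h
    have h2 := mul_le_mul_of_nonneg_right hξ hγ'.le
    have h3 := hε q
    linarith
  have hfs : ∀ q, expGap D am fstar q ≤ 2 * expGap D am g q +
      (Fintype.card A / γ / 3 + 16 / 3 * (ξ * γ) + ε / 3) := by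
    intro q
    have h1 := expGap_le_add_absErr D am fstar g q
    have h2 := herr q
    have h3 := herr (greedy am fstar)
    rw [expGap_greedy] at h3
    have h4 := expGap_nonneg D am g q
    linarith
  refine ⟨hfs q, ?_⟩
  have h1 := expGap_le_add_absErr D am g fstar q
  rw [absErr_comm D g, absErr_comm D g] at h1
  have h2 := herr q
  have h3 := herr (greedy am g)
  -- The error under the kernel greedy for g involves its gap for fstar; the direction already
  -- proved bounds that gap, since its gap for g is zero.
  have h4 := hfs (greedy am g)
  rw [expGap_greedy] at h4
  have h5 := expGap_nonneg D am fstar q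
  linarith

end InverseGapWeighting

/-! ### Summation over epochs and numerical bounds on the rates -/

section Rates

/-- The epoch that contains the round `t`. -/
noncomputable def epochIdx (τ₁ t : ℕ) : ℕ := sInf {m | t ≤ epochEnd τ₁ m}

lemma epochIdx_eq {τ₁ m t : ℕ} (h1 : epochEnd τ₁ m < t) (h2 : t ≤ epochEnd τ₁ (m + 1)) :
    epochIdx τ₁ t = m + 1 := by
  refine le_antisymm (Nat.sInf_le h2) ?_
  by_contra hcon
  have hmem : t ≤ epochEnd τ₁ (epochIdx τ₁ t) := Nat.sInf_mem (s := {m | t ≤ epochEnd τ₁ m}) ⟨_, h2⟩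
  have := hmem.trans (epochEnd_mono τ₁ (by omega : epochIdx τ₁ t ≤ m))
  omega

lemma exists_mem_epoch {τ₁ : ℕ} (hτ₁ : 2 ≤ τ₁) {t : ℕ} (ht : 1 ≤ t) :
    ∃ m, epochEnd τ₁ m < t ∧ t ≤ epochEnd τ₁ (m + 1) ∧ epochIdx τ₁ t = m + 1 := by
  obtain ⟨m, hm⟩ := exists_epoch hτ₁ t
  induction m with
  | zero => simp [epochEnd] at hm; omega
  | succ m ih =>
    by_cases h : t ≤ epochEnd τ₁ m
    · exact ih h
    · exact ⟨m, by omega, hm, epochIdx_eq (by omega) hm⟩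

lemma sum_Icc_epochEnd_succ (τ₁ : ℕ) (ρ : ℕ → ℝ) (m : ℕ) :
    ∑ s ∈ Finset.Icc 1 (epochEnd τ₁ (m + 1)), ρ (epochIdx τ₁ s) =
      ∑ s ∈ Finset.Icc 1 (epochEnd τ₁ m), ρ (epochIdx τ₁ s) +
        epochLen τ₁ (m + 1) * ρ (m + 1) := by
  have hle : epochEnd τ₁ m ≤ epochEnd τ₁ (m + 1) := epochEnd_mono τ₁ (Nat.le_succ m)
  have h := Finset.sum_Ioc_consecutive (fun s => ρ (epochIdx τ₁ s)) (Nat.zero_le (epochEnd τ₁ m))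
    hle
  have e : ∀ n, Finset.Icc 1 n = Finset.Ioc 0 n := fun n => by ext; simp; omega
  rw [e, e, ← h]
  congr 1
  rw [Finset.sum_congr rfl (g := fun _ => ρ (m + 1)) fun s hs => by
    rw [epochIdx_eq (Finset.mem_Ioc.1 hs).1 (Finset.mem_Ioc.1 hs).2]]
  simp [epochLen]

/-- Summation of a per-epoch regret with a geometrically contracting error. -/
theorem sum_epochs_le {τ₁ m₀ : ℕ} (hm₀ : 2 ≤ m₀) {ρ ε y : ℕ → ℝ} {G : ℝ}
    (hG : 0 ≤ G) (hρ1 : ∀ m, ρ m ≤ 1) (hε₀ : ε m₀ ≤ 1)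
    (hε : ∀ m, m₀ ≤ m → ε (m + 1) ≤ 8 * y m + ε m / 3)
    (hρ : ∀ m, m₀ ≤ m → ρ m ≤ 6 * y m + ε m) {m₁ : ℕ}
    (hy : ∀ m, m₀ ≤ m → m ≤ m₁ → y m * √(epochEnd τ₁ m) ≤ 2 * G) :
    ∀ m, m₀ ≤ m → m ≤ m₁ →
      ∑ s ∈ Finset.Icc 1 (epochEnd τ₁ m), ρ (epochIdx τ₁ s) + epochEnd τ₁ m * ε m ≤
        2 * epochEnd τ₁ m₀ + 200 * (G * √(epochEnd τ₁ m)) := by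
  intro m hm
  induction m, hm using Nat.le_induction with
  | base =>
    intro _
    have h1 : ∑ s ∈ Finset.Icc 1 (epochEnd τ₁ m₀), ρ (epochIdx τ₁ s) ≤ epochEnd τ₁ m₀ := by
      refine (Finset.sum_le_sum fun s _ => hρ1 _).trans ?_
      simp
    have h2 : (epochEnd τ₁ m₀ : ℝ) * ε m₀ ≤ epochEnd τ₁ m₀ :=
      mul_le_of_le_one_right (Nat.cast_nonneg _) hε₀
    have h3 : 0 ≤ G * √(epochEnd τ₁ m₀) := by positivity
    linarith
  | succ m hm ih =>
    intro hm1
    have ih := ih (by omega)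
    obtain ⟨k, rfl⟩ : ∃ k, m = k + 1 := ⟨m - 1, by omega⟩
    have hT : (epochEnd τ₁ (k + 1 + 1) : ℝ) = 2 * epochEnd τ₁ (k + 1) := by
      rw [epochEnd_succ_succ]; push_cast; ring
    rw [sum_Icc_epochEnd_succ, epochLen_succ_succ, hT]
    have hy1 := hy (k + 1) hm (by omega)
    have hy2 := hy (k + 1 + 1) (by omega) hm1
    have hr := hρ (k + 1 + 1) (by omega)
    have he := hε (k + 1) hm
    rw [hT] at hy2
    set T : ℝ := ((epochEnd τ₁ (k + 1) : ℕ) : ℝ)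
    set y1 := y (k + 1)
    set y2 := y (k + 1 + 1)
    have hT0 : 0 ≤ T := Nat.cast_nonneg _
    have hsq : √T * √T = T := Real.mul_self_sqrt hT0
    have hs0 : 0 ≤ √T := Real.sqrt_nonneg _
    have h2 : √(2 * T) = √2 * √T := Real.sqrt_mul (by norm_num) T
    have hr2 : (1.4 : ℝ) ≤ √2 := Real.le_sqrt_of_sq_le (by norm_num)
    rw [h2] at hy2 ⊢
    have a1 : T * y1 ≤ 2 * (G * √T) := by
      calc T * y1 = y1 * √T * √T := by rw [mul_assoc, hsq, mul_comm]
        _ ≤ 2 * G * √T := mul_le_mul_of_nonneg_right hy1 hs0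
        _ = _ := by ring
    have a2 : T * y2 ≤ 2 * (G * √T) := by
      rcases le_or_gt y2 0 with h | h
      · exact (mul_nonpos_of_nonneg_of_nonpos hT0 h).trans (by positivity)
      · calc T * y2 = y2 * (1 * √T) * √T := by rw [one_mul, mul_assoc, hsq, mul_comm]
          _ ≤ y2 * (√2 * √T) * √T := by gcongr; linarith
          _ ≤ 2 * G * √T := mul_le_mul_of_nonneg_right hy2 hs0
          _ = _ := by ring
    -- The new epoch adds T ε and the doubled potential 2 T ε, both at the new ε; the contraction by
    -- 1/3 turns 3 T ε into the old potential plus 24 T y1. The increment is at most 60 G√T, below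
    -- 200 (√2 - 1) G√T.
    have a3 : T * ρ (k + 1 + 1) ≤ 6 * (T * y2) + T * ε (k + 1 + 1) := by
      have := mul_le_mul_of_nonneg_left hr hT0
      linarith
    have a4 : T * ε (k + 1 + 1) ≤ 8 * (T * y1) + T * ε (k + 1) / 3 := by
      have := mul_le_mul_of_nonneg_left he hT0
      linarith
    have a5 : 1.4 * (G * √T) ≤ G * (√2 * √T) := by
      have : 0 ≤ G * √T := by positivity
      nlinarith
    have a6 : 0 ≤ G * √T := by positivity
    linarith

/-- The estimation rate of a class of dimension `d` after epoch `m`. -/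
noncomputable def epochRate (τ₁ M : ℕ) (δ C₁ : ℝ) (d m : ℕ) : ℝ :=
  estRate C₁ d (epochLen τ₁ m) (conf M δ m)

lemma log_one_div_conf (M : ℕ) (δ : ℝ) (m : ℕ) :
    Real.log (1 / conf M δ m) = Real.log (4 * M * (m : ℝ) ^ 2 / δ) := by
  rw [conf, one_div_div]

variable {τ₁ M : ℕ} {δ C₁ : ℝ} {d : ℕ}

lemma four_lt_inv_conf (hM : 1 ≤ M) (hδ : δ ∈ Set.Ioo (0 : ℝ) 1) {m : ℕ} (hm : 1 ≤ m) :
    4 < 4 * M * (m : ℝ) ^ 2 / δ := by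
  have hM' : (1 : ℝ) ≤ M := by exact_mod_cast hM
  have hm' : (1 : ℝ) ≤ m := by exact_mod_cast hm
  rw [lt_div_iff₀ hδ.1]
  have h1 : (1 : ℝ) ≤ M * (m : ℝ) ^ 2 := one_le_mul_of_one_le_of_one_le hM' (one_le_pow₀ hm')
  linarith [hδ.2]

lemma epochRate_pos (hτ₁ : 2 ≤ τ₁) (hM : 1 ≤ M) (hδ : δ ∈ Set.Ioo (0 : ℝ) 1) (hC₁ : 0 < C₁)
    (hd : 0 < d) {m : ℕ} (hm : 1 ≤ m) : 0 < epochRate τ₁ M δ C₁ d m := by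
  obtain ⟨k, rfl⟩ : ∃ k, m = k + 1 := ⟨m - 1, by omega⟩
  have h1 := two_le_epochLen hτ₁ k
  have h2 : (2 : ℝ) ≤ epochLen τ₁ (k + 1) := by exact_mod_cast h1
  have h3 := four_lt_inv_conf hM hδ hm
  rw [epochRate, estRate, log_one_div_conf]
  have h4 : 0 < Real.log (epochLen τ₁ (k + 1)) := Real.log_pos (by linarith)
  have h5 := Real.log_pos (by linarith : 1 < 4 * M * ((k + 1 : ℕ) : ℝ) ^ 2 / δ)
  have h6 : (0 : ℝ) < d := by exact_mod_cast hd
  positivity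

/-- The quotient ln(n)/n does not grow from one epoch to the next, and the confidence logarithm at
most doubles: (m+1)² ≤ 4 m² adds at most ln 4, which is below that logarithm itself. -/
lemma epochRate_succ_le (hτ₁ : 2 ≤ τ₁) (hM : 1 ≤ M) (hδ : δ ∈ Set.Ioo (0 : ℝ) 1) (hC₁ : 0 < C₁)
    {m : ℕ} (hm : 1 ≤ m) :
    epochRate τ₁ M δ C₁ d (m + 1) ≤ 2 * epochRate τ₁ M δ C₁ d m := by
  obtain ⟨k, rfl⟩ : ∃ k, m = k + 1 := ⟨m - 1, by omega⟩
  rw [epochRate, estRate, epochRate, estRate, log_one_div_conf, log_one_div_conf]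
  have hδ0 := hδ.1
  have hM' : (1 : ℝ) ≤ M := by exact_mod_cast hM
  have h3 := four_lt_inv_conf hM hδ hm
  set L := Real.log (4 * M * ((k + 1 : ℕ) : ℝ) ^ 2 / δ) with hL
  have hL4 : Real.log 4 ≤ L := Real.log_le_log (by norm_num) h3.le
  have hL0 : 0 ≤ L := (Real.log_nonneg (by norm_num)).trans hL4
  have hL' : Real.log (4 * M * ((k + 1 + 1 : ℕ) : ℝ) ^ 2 / δ) ≤ 2 * L := by
    have e : (4 : ℝ) * (4 * M * ((k + 1 : ℕ) : ℝ) ^ 2 / δ) =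
        4 * M * (2 * ((k + 1 : ℕ) : ℝ)) ^ 2 / δ := by ring
    have h : Real.log (4 * M * ((k + 1 + 1 : ℕ) : ℝ) ^ 2 / δ) ≤
        Real.log (4 * (4 * M * ((k + 1 : ℕ) : ℝ) ^ 2 / δ)) := by
      rw [e]
      refine Real.log_le_log (by positivity) ?_
      gcongr
      push_cast
      linarith [(Nat.cast_nonneg k : (0 : ℝ) ≤ k)]
    rw [Real.log_mul (by norm_num) (by linarith)] at h
    linarith
  have hLn : 0 ≤ Real.log (4 * M * ((k + 1 + 1 : ℕ) : ℝ) ^ 2 / δ) :=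
    Real.log_nonneg (by linarith [four_lt_inv_conf hM hδ (by omega : 1 ≤ k + 1 + 1)])
  have hn := two_le_epochLen hτ₁ k
  have hn2 : (2 : ℝ) ≤ epochLen τ₁ (k + 1) := by exact_mod_cast hn
  have key : Real.log (epochLen τ₁ (k + 1 + 1)) / epochLen τ₁ (k + 1 + 1) ≤
      Real.log (epochLen τ₁ (k + 1)) / epochLen τ₁ (k + 1) := by
    rcases k with _ | k
    -- The first two epochs have the same length τ₁.
    · rw [zero_add, epochLen_succ_succ τ₁ 0, epochLen_one]; rfl
    · rw [epochLen_succ_succ, epochEnd_succ_succ, epochLen_succ_succ]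
      rw [epochLen_succ_succ] at hn2
      push_cast
      set n : ℝ := ((epochEnd τ₁ (k + 1) : ℕ) : ℝ)
      have hn0 : 0 < n := by linarith
      rw [Real.log_mul (by norm_num) hn0.ne', div_le_div_iff₀ (by positivity) hn0]
      have : Real.log 2 ≤ Real.log n := Real.log_le_log (by norm_num) hn2
      nlinarith
  have hlog : 0 ≤ Real.log (epochLen τ₁ (k + 1)) := Real.log_nonneg (by linarith)
  calc C₁ * d * Real.log (epochLen τ₁ (k + 1 + 1)) *
        Real.log (4 * M * ((k + 1 + 1 : ℕ) : ℝ) ^ 2 / δ) / epochLen τ₁ (k + 1 + 1)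
      = C₁ * d * (Real.log (epochLen τ₁ (k + 1 + 1)) / epochLen τ₁ (k + 1 + 1)) *
        Real.log (4 * M * ((k + 1 + 1 : ℕ) : ℝ) ^ 2 / δ) := by ring
    _ ≤ C₁ * d * (Real.log (epochLen τ₁ (k + 1)) / epochLen τ₁ (k + 1)) * (2 * L) := by
        gcongr
    _ = _ := by ring

lemma le_log_three : (1.05 : ℝ) ≤ Real.log 3 := by
  rw [Real.le_log_iff_exp_le (by norm_num)]
  have h1 : Real.exp 1.05 = Real.exp 1 * Real.exp 0.05 := by
    rw [← Real.exp_add]; norm_num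
  have h2 : Real.exp 0.05 ≤ 1.06 := by
    have := Real.exp_bound_div_one_sub_of_interval (x := 0.05) (by norm_num) (by norm_num)
    exact this.trans (by norm_num)
  have h3 := Real.exp_one_lt_d9
  rw [h1]
  nlinarith [Real.exp_pos 1, Real.exp_pos 0.05]

/-- The hypothesis t ≥ 3 forces ln t > 1 with a margin, so ln(M ln t / δ) stays away from zero and
can absorb additive constants; 1/21 is 1 - 1/1.05. -/
lemma log_bounds (hM : 1 ≤ M) (hδ : δ ∈ Set.Ioo (0 : ℝ) 1) {t : ℕ} (ht : 3 ≤ t) :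
    1.05 ≤ Real.log t ∧ 1 / 21 ≤ Real.log (M * Real.log t / δ) ∧
      Real.log (1 / δ) ≤ Real.log (M * Real.log t / δ) := by
  have hM' : (1 : ℝ) ≤ M := by exact_mod_cast hM
  have ht' : (3 : ℝ) ≤ t := by exact_mod_cast ht
  have hδ0 := hδ.1
  have h1 : (1.05 : ℝ) ≤ Real.log t :=
    le_log_three.trans (Real.log_le_log (by norm_num) ht')
  have h2 : (1.05 : ℝ) ≤ M * Real.log t := by nlinarith
  refine ⟨h1, ?_, ?_⟩
  · have h3 : (1.05 : ℝ) ≤ M * Real.log t / δ := by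
      rw [le_div_iff₀ hδ.1]; nlinarith [hδ.2]
    have h4 : 1 - (1.05 : ℝ)⁻¹ ≤ Real.log 1.05 := Real.one_sub_inv_le_log_of_pos (by norm_num)
    have h5 : Real.log 1.05 ≤ Real.log (M * Real.log t / δ) := Real.log_le_log (by norm_num) h3
    exact le_trans (by norm_num) (h4.trans h5)
  · refine Real.log_le_log (by positivity) ?_
    gcongr
    linarith

lemma log_sixteen_le : Real.log 16 ≤ 2.8 := by
  have h : (16 : ℝ) = 2 ^ 4 := by norm_num
  rw [h, Real.log_pow]
  have := Real.log_two_lt_d9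
  norm_num
  linarith

lemma epochLen_mul_epochRate_le (hτ₁ : 2 ≤ τ₁) (hM : 1 ≤ M) (hδ : δ ∈ Set.Ioo (0 : ℝ) 1)
    (hC₁ : 0 < C₁) {m t : ℕ} (hm : 1 ≤ m) (ht : 3 ≤ t) (hmt : epochEnd τ₁ m < t) :
    epochLen τ₁ m * epochRate τ₁ M δ C₁ d m ≤
      70 * (C₁ * d * Real.log t * Real.log (M * Real.log t / δ)) := by
  obtain ⟨k, rfl⟩ : ∃ k, m = k + 1 := ⟨m - 1, by omega⟩
  obtain ⟨hlt, hL, -⟩ := log_bounds hM hδ ht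
  set L := Real.log (M * Real.log t / δ) with hLdef
  have hδ0 := hδ.1
  have hM' : (1 : ℝ) ≤ M := by exact_mod_cast hM
  have hn := two_le_epochLen hτ₁ k
  have hnt : epochLen τ₁ (k + 1) ≤ t := by
    have := epochEnd_add_epochLen τ₁ k; omega
  have hn2 : (2 : ℝ) ≤ epochLen τ₁ (k + 1) := by exact_mod_cast hn
  have hnt' : (epochLen τ₁ (k + 1) : ℝ) ≤ t := by exact_mod_cast hnt
  have ht3 : (3 : ℝ) ≤ t := by exact_mod_cast ht
  -- Epochs double, so 2^m ≤ τ_m < t, and 1 / ln 2 < 2.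
  have hkt : ((k + 1 : ℕ) : ℝ) ≤ 2 * Real.log t := by
    have h1 : (2 : ℝ) ^ (k + 1) ≤ t := by
      have : 2 ^ (k + 1) ≤ t := by
        rw [epochEnd_succ] at hmt
        calc 2 ^ (k + 1) = 2 * 2 ^ k := by ring
          _ ≤ τ₁ * 2 ^ k := Nat.mul_le_mul_right _ hτ₁
          _ ≤ t := hmt.le
      exact_mod_cast this
    have h2 := Real.log_le_log (by positivity) h1
    rw [Real.log_pow] at h2
    have h3 := Real.log_two_gt_d9
    have h4 : (0 : ℝ) ≤ ((k + 1 : ℕ) : ℝ) := Nat.cast_nonneg _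
    nlinarith
  -- The logarithm is at most ln 16 + 2L, and ln 16 ≤ 2.8 ≤ 58.8 L because L ≥ 1/21.
  have hΛ : Real.log (4 * M * ((k + 1 : ℕ) : ℝ) ^ 2 / δ) ≤ 70 * L := by
    have hpos : 0 < M * Real.log t / δ := by positivity
    have h1 : 4 * M * ((k + 1 : ℕ) : ℝ) ^ 2 / δ ≤ 16 * (M * Real.log t / δ) ^ 2 := by
      have e : 16 * (M * Real.log t / δ) ^ 2 = 4 * M * (2 * Real.log t) ^ 2 / δ * (M / δ) := by
        field_simp; norm_num
      rw [e]
      have h2 : 1 ≤ M / δ := by rw [le_div_iff₀ hδ0]; linarith [hδ.2]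
      refine le_trans ?_ (le_mul_of_one_le_right (by positivity) h2)
      gcongr
    have h2 := Real.log_le_log (by positivity) h1
    rw [Real.log_mul (by norm_num) (by positivity), Real.log_pow] at h2
    have h3 := log_sixteen_le
    push_cast at h2
    rw [← hLdef] at h2
    push_cast
    linarith
  rw [epochRate, estRate, log_one_div_conf, mul_div_cancel₀ _ (by positivity)]
  have hl1 : Real.log (epochLen τ₁ (k + 1)) ≤ Real.log t := Real.log_le_log (by linarith) hnt'
  have hl0 : 0 ≤ Real.log (epochLen τ₁ (k + 1)) := Real.log_nonneg (by linarith)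
  have hΛ0 : 0 ≤ Real.log (4 * M * ((k + 1 : ℕ) : ℝ) ^ 2 / δ) :=
    Real.log_nonneg (by linarith [four_lt_inv_conf hM hδ hm])
  calc C₁ * d * Real.log (epochLen τ₁ (k + 1)) * Real.log (4 * M * ((k + 1 : ℕ) : ℝ) ^ 2 / δ)
      ≤ C₁ * d * Real.log t * (70 * L) := by gcongr
    _ = _ := by ring

lemma log_sixteen_mul_sq_div_le (hM : 1 ≤ M) (hδ : δ ∈ Set.Ioo (0 : ℝ) 1) {t : ℕ} (ht : 3 ≤ t) :
    Real.log (16 * t ^ 2 / δ) ≤ 110 * (Real.log t * Real.log (M * Real.log t / δ)) := by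
  obtain ⟨hlt, hL, hδL⟩ := log_bounds hM hδ ht
  have hδ0 := hδ.1
  have ht3 : (3 : ℝ) ≤ t := by exact_mod_cast ht
  have e : (16 * t ^ 2 / δ : ℝ) = 16 * (t ^ 2 * (1 / δ)) := by ring
  rw [e, Real.log_mul (by norm_num) (by positivity), Real.log_mul (by positivity) (by positivity),
    Real.log_pow]
  have h3 := log_sixteen_le
  push_cast
  nlinarith [mul_nonneg (sub_nonneg.2 hlt) (sub_nonneg.2 hL)]

end Rates

/-! ### The regret bound along a good path -/

section PathwiseRegret

/-- Here x is the rate of class i* and x' the rate of the class that sets γ. A mismatch by a factor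
3 only affects the constants: √8 ≤ 3 and √(3/8) ≤ 0.65. -/
lemma igw_rate_bounds {K x x' : ℝ} (hK : 0 < K) (hx' : 0 < x') (h1 : x' ≤ x) (h2 : x ≤ 3 * x') :
    K / √(K / (8 * x')) ≤ 3 * √(K * x) ∧ x * √(K / (8 * x')) ≤ 0.65 * √(K * x) := by
  have hx : 0 < x := hx'.trans_le h1
  have hγ : 0 < √(K / (8 * x')) := Real.sqrt_pos.2 (by positivity)
  constructor
  · rw [div_le_iff₀ hγ, mul_assoc, ← Real.sqrt_mul (by positivity)]
    have : K / 3 ≤ √(K * x * (K / (8 * x'))) := by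
      refine Real.le_sqrt_of_sq_le ?_
      rw [mul_div_assoc', le_div_iff₀ (by positivity)]
      nlinarith [mul_pos hK hK]
    linarith
  · have e : 0.65 * √(K * x) = √(0.4225 * (K * x)) := by
      rw [show (0.4225 : ℝ) = 0.65 ^ 2 by norm_num,
        Real.sqrt_mul (by norm_num : (0 : ℝ) ≤ 0.65 ^ 2) (K * x), Real.sqrt_sq (by norm_num)]
    rw [e]
    refine Real.le_sqrt_of_sq_le ?_
    rw [mul_pow, Real.sq_sqrt (by positivity), mul_div_assoc', div_le_iff₀ (by positivity)]
    nlinarith [mul_pos hK hx]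

variable {X A : Type*} [MeasurableSpace X] [Fintype A] [MeasurableSpace A]
  [MeasurableSingletonClass A]

/-- The sum of the conditional expectations of the regret of the rounds `1, …, t`, on a path on
which the estimated models are accurate and the class indices are eventually adequate. -/
theorem sum_expGap_le [Nonempty A] (D : Measure (X × (A → ℝ))) [IsProbabilityMeasure D]
    {M τ₁ : ℕ} {δ C₁ : ℝ} (hτ₁ : 2 ≤ τ₁) (hM : 1 ≤ M) (hδ : δ ∈ Set.Ioo (0 : ℝ) 1) (hC₁ : 0 < C₁)
    {d : ℕ → ℕ} (am : ArgmaxRule A) (fstar : Model X A) (est : EstOracle X A) (mt : TestOracle X A)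
    (z : ℕ → Obs X A) {istar m₀ : ℕ} (hm₀ : 2 ≤ m₀)
    (hrisk : ∀ m, 1 ≤ m → risk D fstar (fhat τ₁ est z (m + 1))
      (epochKernel M τ₁ δ C₁ d am est mt z m) ≤ epochRate τ₁ M δ C₁ (d istar) m)
    (hidx : ∀ m, m₀ ≤ m → 0 < d (currentIndex M τ₁ δ mt z m) ∧
      d (currentIndex M τ₁ δ mt z m) ≤ d istar ∧
      d istar ≤ 3 * d (currentIndex M τ₁ δ mt z m)) {t : ℕ} (ht : 3 ≤ t) :
    ∑ s ∈ Finset.Icc 1 t, expGap D am fstar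
      (epochKernel M τ₁ δ C₁ d am est mt z (epochIdx τ₁ s)) ≤
      2 * epochEnd τ₁ m₀ + 300 * √(70 * C₁) * √((Fintype.card A : ℝ) * d istar * t * Real.log t *
        Real.log (M * Real.log t / δ)) := by
  set K : ℝ := (Fintype.card A : ℝ) with hKdef
  have hK : 0 < K := by rw [hKdef]; exact_mod_cast Fintype.card_pos
  set p := epochKernel M τ₁ δ C₁ d am est mt z
  set x : ℕ → ℝ := epochRate τ₁ M δ C₁ (d istar)
  set y : ℕ → ℝ := fun m => √(K * x (m - 1)) with hy
  set γ := gammaUsed M τ₁ δ C₁ d mt z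
  have hdpos : 0 < d istar := (hidx m₀ le_rfl).1.trans_le (hidx m₀ le_rfl).2.1
  have hxpos : ∀ m, 1 ≤ m → 0 < x m := fun m hm => epochRate_pos hτ₁ hM hδ hC₁ hdpos hm
  -- The parameter γ m is tuned to the rate of epoch m - 1, whereas the model fitted in epoch m has
  -- risk x m; `epochRate_succ_le` bridges the two and turns 0.65 into 1.3.
  have hγ : ∀ m, m₀ ≤ m → 0 < γ m ∧ K / γ m ≤ 3 * y m ∧ x m * γ m ≤ 1.3 * y m := by
    intro m hm
    obtain ⟨k, rfl⟩ : ∃ k, m = k + 2 := ⟨m - 2, by omega⟩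
    obtain ⟨h1, h2, h3⟩ := hidx _ hm
    set i := currentIndex M τ₁ δ mt z (k + 2)
    have hxi : 0 < epochRate τ₁ M δ C₁ (d i) (k + 1) :=
      epochRate_pos hτ₁ hM hδ hC₁ h1 (by omega)
    have hγe : (γ (k + 2) : ℝ) = √(K / (8 * epochRate τ₁ M δ C₁ (d i) (k + 1))) := rfl
    -- Rates are proportional to dimensions, so comparable dimensions give comparable rates.
    have hprop : ∀ a b : ℕ, (b : ℝ) * epochRate τ₁ M δ C₁ a (k + 1) =
        a * epochRate τ₁ M δ C₁ b (k + 1) := fun a b => by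
      simp only [epochRate, estRate]; ring
    have hdi : (0 : ℝ) < d i := by exact_mod_cast h1
    have h2' : (d i : ℝ) ≤ d istar := by exact_mod_cast h2
    have h3' : (d istar : ℝ) ≤ 3 * d i := by exact_mod_cast h3
    have hpe := hprop (d istar) (d i)
    have e1 : epochRate τ₁ M δ C₁ (d i) (k + 1) ≤ x (k + 1) := by
      have : (d i : ℝ) * epochRate τ₁ M δ C₁ (d i) (k + 1) ≤ d i * x (k + 1) := by
        rw [hpe]; exact mul_le_mul_of_nonneg_right h2' hxi.le
      exact le_of_mul_le_mul_left this hdi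
    have e2 : x (k + 1) ≤ 3 * epochRate τ₁ M δ C₁ (d i) (k + 1) := by
      have : (d i : ℝ) * x (k + 1) ≤ d i * (3 * epochRate τ₁ M δ C₁ (d i) (k + 1)) := by
        rw [hpe]
        calc _ ≤ 3 * (d i : ℝ) * epochRate τ₁ M δ C₁ (d i) (k + 1) :=
              mul_le_mul_of_nonneg_right h3' hxi.le
          _ = _ := by ring
      exact le_of_mul_le_mul_left this hdi
    obtain ⟨b1, b2⟩ := igw_rate_bounds hK hxi e1 e2
    have hyk : y (k + 2) = √(K * x (k + 1)) := rfl
    have hpos : (0 : ℝ) < γ (k + 2) := by rw [hγe]; exact Real.sqrt_pos.2 (by positivity)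
    refine ⟨hpos, by rw [hγe, hyk]; exact b1, ?_⟩
    have hx2 : x (k + 2) ≤ 2 * x (k + 1) := epochRate_succ_le hτ₁ hM hδ hC₁ (by omega)
    rw [← hγe] at b2
    rw [hyk]
    nlinarith
  -- The additive comparison error, k epochs after m₀. It starts at 1 because gaps never exceed 1.
  let e : ℕ → ℝ := fun k => Nat.rec 1 (fun k r => 8 * y (m₀ + k) + r / 3) k
  have he0 : e 0 = 1 := rfl
  have hes : ∀ k, e (k + 1) = 8 * y (m₀ + k) + e k / 3 := fun _ => rfl
  have hy0 : ∀ m, 0 ≤ y m := fun m => Real.sqrt_nonneg _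
  have hen : ∀ k, 0 ≤ e k := by
    intro k
    induction k with
    | zero => rw [he0]; norm_num
    | succ k ih => rw [hes]; linarith [hy0 (m₀ + k)]
  have hcomp : ∀ k q, expGap D am fstar q ≤ 2 * expGap D am (fhat τ₁ est z (m₀ + k)) q + e k ∧
      expGap D am (fhat τ₁ est z (m₀ + k)) q ≤ 2 * expGap D am fstar q + e k := by
    intro k
    induction k with
    | zero =>
      intro q
      have h1 := expGap_le_one D am fstar q
      have h2 := expGap_le_one D am (fhat τ₁ est z m₀) q
      have h3 := expGap_nonneg D am fstar q
      have h4 := expGap_nonneg D am (fhat τ₁ est z m₀) q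
      rw [he0, add_zero]
      constructor <;> linarith
    | succ k ih =>
      intro q
      obtain ⟨g0, g1, g2⟩ := hγ (m₀ + k) (by omega)
      have h := expGap_comparison_step D am g0 (fun q => (ih q).2)
        (hrisk (m₀ + k) (by omega)) q
      -- The first two terms add up to at most (1 + 16/3 · 1.3) y < 8 y.
      have hle : (K / γ (m₀ + k) / 3 + 16 / 3 * (x (m₀ + k) * γ (m₀ + k)) + e k / 3 : ℝ) ≤
          e (k + 1) := by
        rw [hes]; linarith [hy0 (m₀ + k)]
      rw [add_assoc] at h
      exact ⟨h.1.trans (by linarith), h.2.trans (by linarith)⟩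
  set L := Real.log (M * Real.log t / δ)
  obtain ⟨hlt, hL, -⟩ := log_bounds hM hδ ht
  set G := √(70 * C₁) * √(K * d istar * Real.log t * L) with hG
  have hG0 : 0 ≤ G := by positivity
  have hdr : (0 : ℝ) < d istar := by exact_mod_cast hdpos
  have hGsq : G ^ 2 = K * (70 * (C₁ * d istar * Real.log t * L)) := by
    rw [hG, mul_pow, Real.sq_sqrt (by positivity), Real.sq_sqrt (by positivity)]; ring
  obtain ⟨m, hm1, hm2, -⟩ := exists_mem_epoch hτ₁ (by omega : 1 ≤ t)
  have hρ1 : ∀ m, expGap D am fstar (p m) ≤ 1 := fun m => expGap_le_one D am fstar _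
  have hρ0 : ∀ m, 0 ≤ expGap D am fstar (p m) := fun m => expGap_nonneg D am fstar _
  have hW : G * √t = √(70 * C₁) * √(K * d istar * t * Real.log t * L) := by
    rw [hG, mul_assoc, ← Real.sqrt_mul (by positivity)]
    congr 2; ring
  have hGt : 0 ≤ G * √t := by positivity
  rw [mul_assoc, ← hW]
  -- Before the start epoch the trivial regret of 1 per round suffices.
  by_cases hmm : m + 1 < m₀
  · have h1 : ∑ s ∈ Finset.Icc 1 t, expGap D am fstar (p (epochIdx τ₁ s)) ≤ t := by
      refine (Finset.sum_le_sum fun s _ => hρ1 _).trans ?_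
      simp
    have h2 : (t : ℝ) ≤ epochEnd τ₁ m₀ := by
      exact_mod_cast hm2.trans (epochEnd_mono τ₁ hmm.le)
    have h3 : (0 : ℝ) ≤ epochEnd τ₁ m₀ := Nat.cast_nonneg _
    linarith
  · have hy' : ∀ k, m₀ ≤ k → k ≤ m + 1 → y k * √(epochEnd τ₁ k) ≤ 2 * G := by
      intro k hk1 hk2
      obtain ⟨j, rfl⟩ : ∃ j, k = j + 2 := ⟨k - 2, by omega⟩
      have hlt : epochEnd τ₁ (j + 1) < t := (epochEnd_mono τ₁ (by omega)).trans_lt hm1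
      have hr := epochLen_mul_epochRate_le (d := d istar) hτ₁ hM hδ hC₁
        (by omega : 1 ≤ j + 1) ht hlt
      have hlen : (epochEnd τ₁ (j + 2) : ℝ) ≤ 4 * epochLen τ₁ (j + 1) := by
        have : epochEnd τ₁ (j + 2) ≤ 4 * epochLen τ₁ (j + 1) := by
          rcases j with _ | j
          · rw [zero_add, zero_add, epochLen_one, epochEnd_succ]; omega
          · rw [epochLen_succ_succ, epochEnd_succ_succ, epochEnd_succ_succ]; omega
        exact_mod_cast this
      change √(K * x (j + 1)) * _ ≤ _
      have hx1 := hxpos (j + 1) (by omega)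
      rw [← Real.sqrt_mul (by positivity)]
      refine Real.sqrt_le_iff.2 ⟨by positivity, ?_⟩
      rw [mul_pow, hGsq]
      calc K * x (j + 1) * epochEnd τ₁ (j + 2)
          ≤ K * x (j + 1) * (4 * epochLen τ₁ (j + 1)) := by gcongr
        _ = 4 * (K * (epochLen τ₁ (j + 1) * x (j + 1))) := by ring
        _ ≤ 4 * (K * (70 * (C₁ * d istar * Real.log t * L))) := by gcongr
        _ = _ := by ring
    have hsum := sum_epochs_le (τ₁ := τ₁) hm₀ (ρ := fun m => expGap D am fstar (p m))
      (ε := fun m => e (m - m₀)) (y := y) hG0 hρ1 (by simp [he0])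
      (fun k hk => by
        obtain ⟨j, rfl⟩ := Nat.exists_eq_add_of_le hk
        have : m₀ + j + 1 - m₀ = j + 1 := by omega
        simp only [this, hes, Nat.add_sub_cancel_left, le_refl])
      (fun k hk => by
        obtain ⟨j, rfl⟩ := Nat.exists_eq_add_of_le hk
        obtain ⟨g0, g1, -⟩ := hγ (m₀ + j) (by omega)
        have h1 := (hcomp j (p (m₀ + j))).1
        have h2 : expGap D am (fhat τ₁ est z (m₀ + j)) (p (m₀ + j)) ≤ K / γ (m₀ + j) :=
          expGap_igwKernel_le D am g0 _
        simp only [Nat.add_sub_cancel_left]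
        linarith) hy' (m + 1) (by omega) le_rfl
    have hmono : ∑ s ∈ Finset.Icc 1 t, expGap D am fstar (p (epochIdx τ₁ s)) ≤
        ∑ s ∈ Finset.Icc 1 (epochEnd τ₁ (m + 1)), expGap D am fstar (p (epochIdx τ₁ s)) :=
      Finset.sum_le_sum_of_subset_of_nonneg (Finset.Icc_subset_Icc_right hm2)
        fun s _ _ => hρ0 _
    have hnn : 0 ≤ (epochEnd τ₁ (m + 1) : ℝ) * e (m + 1 - m₀) :=
      mul_nonneg (Nat.cast_nonneg _) (hen _)
    -- Completing the epoch of t at most doubles the horizon; 200 · 1.5 is the constant 300.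
    have hsq : √(epochEnd τ₁ (m + 1) : ℝ) ≤ 1.5 * √t := by
      refine Real.sqrt_le_iff.2 ⟨by positivity, ?_⟩
      rw [mul_pow, Real.sq_sqrt (by positivity)]
      obtain ⟨k, rfl⟩ : ∃ k, m = k + 1 := ⟨m - 1, by omega⟩
      rw [epochEnd_succ_succ]
      have : (epochEnd τ₁ (k + 1) : ℝ) ≤ t := by exact_mod_cast hm1.le
      push_cast
      nlinarith [(Nat.cast_nonneg t : (0 : ℝ) ≤ t)]
    have := mul_le_mul_of_nonneg_left hsq hG0
    linarith

end PathwiseRegret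

/-! ### Conditional laws and oracle guarantees along the run -/

section Run

variable {X A : Type*} [MeasurableSpace X] [Fintype A] [MeasurableSpace A]

omit [MeasurableSpace X] [Fintype A] [MeasurableSpace A] in
lemma epochData_congr (τ₁ : ℕ) {z z' : ℕ → Obs X A} {m : ℕ}
    (h : ∀ s ∈ Finset.Icc 1 (epochEnd τ₁ (m + 1)), z s = z' s) :
    epochData τ₁ z (m + 1) = epochData τ₁ z' (m + 1) := by
  funext k
  have := epochEnd_add_epochLen τ₁ m
  refine h _ (Finset.mem_Icc.2 ⟨by omega, ?_⟩)
  have := k.2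
  rw [Nat.add_sub_cancel]
  omega

omit [Fintype A] in
lemma indexSet_congr (M τ₁ : ℕ) (δ : ℝ) (mt : TestOracle X A) {z z' : ℕ → Obs X A} :
    ∀ m, (∀ s ∈ Finset.Icc 1 (epochEnd τ₁ (m - 1)), z s = z' s) →
      indexSet M τ₁ δ mt z m = indexSet M τ₁ δ mt z' m
  | 0, _ => rfl
  | 1, _ => rfl
  | m + 2, h => by
    have hsub : Finset.Icc 1 (epochEnd τ₁ m) ⊆ Finset.Icc 1 (epochEnd τ₁ (m + 1)) :=
      Finset.Icc_subset_Icc_right (epochEnd_mono τ₁ (Nat.le_succ m))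
    rw [indexSet, indexSet, indexSet_congr M τ₁ δ mt (m + 1) fun s hs => h s (hsub hs),
      epochData_congr τ₁ h]

/-- The kernel is frozen before its epoch begins; this makes the data of an epoch conditionally
i.i.d. -/
lemma epochKernel_congr [MeasurableSingletonClass A] (M τ₁ : ℕ) (δ C₁ : ℝ) (d : ℕ → ℕ)
    (am : ArgmaxRule A) (est : EstOracle X A) (mt : TestOracle X A) {z z' : ℕ → Obs X A} (m : ℕ)
    (h : ∀ s ∈ Finset.Icc 1 (epochEnd τ₁ (m - 1)), z s = z' s) :
    epochKernel M τ₁ δ C₁ d am est mt z m = epochKernel M τ₁ δ C₁ d am est mt z' m := by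
  match m with
  | 0 => rfl
  | 1 => rfl
  | m + 2 =>
    have h1 : fhat τ₁ est z (m + 2) = fhat τ₁ est z' (m + 2) := by
      rw [fhat, fhat, epochData_congr τ₁ h]
    have h2 : gammaUsed M τ₁ δ C₁ d mt z (m + 2) = gammaUsed M τ₁ δ C₁ d mt z' (m + 2) := by
      rw [gammaUsed, gammaUsed, currentIndex, currentIndex]
      simp only [indexSet_congr M τ₁ δ mt (m + 2) h]
    rw [epochKernel, epochKernel, h1, h2]

variable [MeasurableSingletonClass A] {Ω : Type*} [MeasurableSpace Ω] {P : Measure Ω}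
  {D : Measure (X × (A → ℝ))} [IsProbabilityMeasure D] {M τ₁ : ℕ} {δ C₁ : ℝ} {d : ℕ → ℕ}
  {am : ArgmaxRule A} {est : EstOracle X A} {mt : TestOracle X A} {z : ℕ → Ω → Obs X A}

theorem IsRun.hasStepLaws (hτ₁ : 2 ≤ τ₁) (h : IsRun P D M τ₁ δ C₁ d am est mt z) :
    HasStepLaws P z fun t w =>
      samplingLaw D (epochKernel M τ₁ δ C₁ d am est mt w (epochIdx τ₁ t)) where
  measurable := h.measurable
  measurable_law t := measurable_samplingLaw D fun a => measurable_epochKernel M τ₁ δ C₁ d am est mt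
    (epochIdx τ₁ t) a
  isProbabilityMeasure t w := isProbabilityMeasure_samplingLaw D _
  congr_past t w w' hw := by
    have : epochKernel M τ₁ δ C₁ d am est mt w (epochIdx τ₁ t) =
        epochKernel M τ₁ δ C₁ d am est mt w' (epochIdx τ₁ t) := by
      refine epochKernel_congr M τ₁ δ C₁ d am est mt _ fun s hs => ?_
      rcases Nat.eq_zero_or_pos t with rfl | ht
      · have h0 : epochIdx τ₁ 0 = 0 := by simp [epochIdx]
        simp [h0, epochEnd] at hs
      · obtain ⟨m, h1, -, h3⟩ := exists_mem_epoch hτ₁ ht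
        rw [h3, Nat.add_sub_cancel] at hs
        exact hw s (Finset.Icc_subset_Icc_right (by omega) hs)
    simp only [this]
  condLaw t ht U hU := by
    obtain ⟨m, h1, h2, h3⟩ := exists_mem_epoch hτ₁ ht
    rw [h3]
    exact h.condLaw (m + 1) (by omega) t h1 h2 U hU

omit [MeasurableSingletonClass A] in
lemma measurableSet_risk_fit_le {Y : Type*} [MeasurableSpace Y] (fstar : Model X A)
    (est : EstOracle X A) (n : ℕ) {p : Y → ProbKernel X A}
    (hp : ∀ a, Measurable fun q : Y × X => (p q.1).prob q.2 a) (ξ : ℝ) :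
    MeasurableSet {q : Y × (Fin n → Obs X A) | risk D fstar (est.fit n q.2) (p q.1) ≤ ξ} := by
  refine measurableSet_le (measurable_risk D fstar (p := fun q : Y × (Fin n → Obs X A) => p q.1)
    (f := fun q => est.fit n q.2) (fun a => ?_) fun a => ?_) measurable_const
  · have h : Measurable fun q : (Y × (Fin n → Obs X A)) × X => (q.1.1, q.2) :=
      (measurable_fst.comp measurable_fst).prodMk measurable_snd
    exact (hp a).comp h
  · have h : Measurable fun q : (Y × (Fin n → Obs X A)) × X => (q.1.2, q.2) :=
      (measurable_snd.comp measurable_fst).prodMk measurable_snd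
    exact (est.measurable_fit n a).comp h

/-- A risk bound that the oracle guarantees for independent samples holds along the run. -/
theorem IsRun.le_measure_risk [IsProbabilityMeasure P] (hτ₁ : 2 ≤ τ₁)
    (h : IsRun P D M τ₁ δ C₁ d am est mt z) (fstar : Model X A) (k : ℕ) {ξ : ℝ} {b : ℝ≥0∞}
    (hb : ∀ p : ProbKernel X A, b ≤ Measure.pi (fun _ : Fin (epochLen τ₁ (k + 1)) =>
      samplingLaw D p) {S | risk D fstar (est.fit _ S) p ≤ ξ}) :
    b ≤ P {ω | risk D fstar (fhat τ₁ est (fun s => z s ω) (k + 2))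
      (epochKernel M τ₁ δ C₁ d am est mt (fun s => z s ω) (k + 1)) ≤ ξ} := by
  have hs := h.hasStepLaws hτ₁
  set E : Set ((ℕ → Obs X A) × (Fin (epochLen τ₁ (k + 1)) → Obs X A)) :=
    {q | risk D fstar (est.fit _ q.2) (epochKernel M τ₁ δ C₁ d am est mt q.1 (k + 1)) ≤ ξ} with hE
  have hEm : MeasurableSet E := measurableSet_risk_fit_le fstar est
    (epochLen τ₁ (k + 1)) (p := fun w => epochKernel M τ₁ δ C₁ d am est mt w (k + 1))
    (measurable_epochKernel M τ₁ δ C₁ d am est mt (k + 1)) ξ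
  have hblock := hs.lintegral_block (T := epochEnd τ₁ k) (n := epochLen τ₁ (k + 1))
    (κ₀ := fun w => samplingLaw D (epochKernel M τ₁ δ C₁ d am est mt w (k + 1)))
    (fun t w h1 h2 => by
      rw [epochEnd_add_epochLen] at h2
      rw [epochIdx_eq h1 h2]) _ le_rfl (φ := E.indicator 1) (measurable_one.indicator hEm)
    (fun w w' S hw => by
      have : epochKernel M τ₁ δ C₁ d am est mt w (k + 1) =
          epochKernel M τ₁ δ C₁ d am est mt w' (k + 1) :=
        epochKernel_congr M τ₁ δ C₁ d am est mt _ (by simpa using hw)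
      simp only [Set.indicator_apply, hE, Set.mem_ofPred_eq, this, Pi.one_apply])
  have e1 : ∫⁻ ω, E.indicator 1 (fun s => z s ω, fun j : Fin (epochLen τ₁ (k + 1)) =>
      z (epochEnd τ₁ k + 1 + j) ω) ∂P = P {ω | risk D fstar
        (fhat τ₁ est (fun s => z s ω) (k + 2))
        (epochKernel M τ₁ δ C₁ d am est mt (fun s => z s ω) (k + 1)) ≤ ξ} := by
    have hmz : Measurable fun ω => ((fun s => z s ω, fun j : Fin (epochLen τ₁ (k + 1)) =>
        z (epochEnd τ₁ k + 1 + j) ω) : (ℕ → Obs X A) × (Fin (epochLen τ₁ (k + 1)) → Obs X A)) :=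
      (measurable_pi_lambda _ h.measurable).prodMk (measurable_pi_lambda _ fun _ => h.measurable _)
    exact lintegral_indicator_one (hmz hEm)
  rw [← e1, hblock]
  calc b = ∫⁻ _, b ∂P := by simp
    _ ≤ _ := lintegral_mono fun ω => by
      refine (hb (epochKernel M τ₁ δ C₁ d am est mt (fun s => z s ω) (k + 1))).trans (le_of_eq ?_)
      exact (lintegral_indicator_one (measurable_prodMk_left hEm)).symm

end Run

/-! ### Consequences of realizability -/

section Realizability

variable {X A : Type*} [MeasurableSpace X] [Fintype A] [MeasurableSpace A]
  (D : Measure (X × (A → ℝ))) [IsProbabilityMeasure D] (fstar : Model X A)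

omit [MeasurableSpace A] [IsProbabilityMeasure D] in
lemma risk_nonneg (f : Model X A) (p : ProbKernel X A) : 0 ≤ risk D fstar f p :=
  integral_nonneg fun x => Finset.sum_nonneg fun a _ => mul_nonneg (p.nonneg x a) (sq_nonneg _)

omit [MeasurableSpace A] in
lemma risk_le_one (f : Model X A) (p : ProbKernel X A) : risk D fstar f p ≤ 1 := by
  have := Measure.isProbabilityMeasure_map (μ := D) (measurable_fst (α := X)).aemeasurable
  have hmem : ∀ x a, (f.toFun x a - fstar.toFun x a) ^ 2 ∈ Set.Icc (0 : ℝ) 1 := fun x a => by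
    have h := abs_model_sub_mem_Icc f fstar x a
    rw [← sq_abs]
    exact ⟨by positivity, pow_le_one₀ h.1 h.2⟩
  have h : risk D fstar f p ≤ ∫ _, (1 : ℝ) ∂(D.map Prod.fst) := by
    refine integral_mono (integrable_sum_prob_mul D p (fun a =>
      ((f.measurable_toFun a).sub (fstar.measurable_toFun a)).pow_const 2) hmem)
      (integrable_const _) fun x => ?_
    simp only
    rw [← p.sum_eq_one x]
    exact Finset.sum_le_sum fun a _ => mul_le_of_le_one_right (p.nonneg x a) (hmem x a).2
  simpa using h

omit [MeasurableSpace A] [IsProbabilityMeasure D] in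
lemma misspec_nonneg (F : Set (Model X A)) (p : ProbKernel X A) : 0 ≤ misspec D fstar F p :=
  Real.iInf_nonneg fun f => risk_nonneg D fstar f p

omit [MeasurableSpace A] in
lemma misspec_le_one (F : Set (Model X A)) (p : ProbKernel X A) : misspec D fstar F p ≤ 1 := by
  rcases isEmpty_or_nonempty F with h | ⟨⟨f⟩⟩
  · rw [misspec, Real.iInf_of_isEmpty]; exact zero_le_one
  · exact (ciInf_le ⟨0, by rintro _ ⟨g, rfl⟩; exact risk_nonneg D fstar g p⟩ f).trans
      (risk_le_one D fstar f p)

-- The bound by 1 matters: a real supremum of an unbounded family would be 0 by default and would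
-- say nothing about its members.
omit [MeasurableSpace A] in
lemma misspec_eq_zero {F : Set (Model X A)} (h : maxMisspec D fstar F = 0) (p : ProbKernel X A) :
    misspec D fstar F p = 0 := by
  refine le_antisymm ?_ (misspec_nonneg D fstar F p)
  rw [← h]
  exact le_ciSup (f := fun p => misspec D fstar F p)
    ⟨1, by rintro _ ⟨q, rfl⟩; exact misspec_le_one D fstar F q⟩ p

omit [MeasurableSpace A] [IsProbabilityMeasure D] in
lemma maxMisspec_nonneg (F : Set (Model X A)) : 0 ≤ maxMisspec D fstar F :=
  Real.iSup_nonneg fun p => misspec_nonneg D fstar F p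

-- The minimal misspecification up to a realizable class is zero, while all rates are positive, so
-- every epoch is safe. The acceptance guarantee of the test then holds in every epoch.
omit [MeasurableSpace A] [IsProbabilityMeasure D] in
lemma safeEpoch_eq_top {M τ₁ : ℕ} (hτ₁ : 2 ≤ τ₁) {F : ℕ → Set (Model X A)} {d : ℕ → ℕ}
    {C₀ C₁ δ : ℝ} (hC₀ : 1 ≤ C₀) (hC₁ : 0 < C₁) (hδ : δ ∈ Set.Ioo (0 : ℝ) 1) {i : ℕ}
    (hi : i ∈ Finset.Icc 1 M) (hd : 0 < d i) (h : maxMisspec D fstar (F i) = 0) :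
    safeEpoch D fstar M τ₁ F d C₀ C₁ δ i = ⊤ := by
  have hi' := Finset.mem_Icc.1 hi
  have hle : (⨅ i' : Finset.Icc 1 i, maxMisspec D fstar (F i')) ≤ 0 := by
    rw [← h]
    exact ciInf_le (f := fun i' : Finset.Icc 1 i => maxMisspec D fstar (F i'))
      ⟨0, by rintro _ ⟨j, rfl⟩; exact maxMisspec_nonneg D fstar _⟩
      ⟨i, Finset.mem_Icc.2 ⟨hi'.1, le_rfl⟩⟩
  refine ENat.eq_top_iff_forall_ge.2 fun m => ?_
  refine le_trans ?_ (le_sSup (Set.mem_image_of_mem _ (show m + 1 ∈ _ from ⟨by omega, ?_⟩)))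
  · exact_mod_cast Nat.le_succ m
  · have h1 := epochRate_pos (d := d i) hτ₁ (hi'.1.trans hi'.2) hδ hC₁ hd (by omega : 1 ≤ m + 1)
    have h2 : C₀ * (⨅ i' : Finset.Icc 1 i, maxMisspec D fstar (F i')) ≤ 0 :=
      mul_nonpos_of_nonneg_of_nonpos (by linarith) hle
    exact h2.trans h1.le

end Realizability

/-! ### The selected class index -/

section IndexSelection

variable {X A : Type*} [MeasurableSpace X] [MeasurableSpace A] {M τ₁ : ℕ} {δ : ℝ}
  {mt : TestOracle X A} {z : ℕ → Obs X A}

lemma indexSet_subset : ∀ m, indexSet M τ₁ δ mt z m ⊆ Finset.Icc 1 M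
  | 0 => subset_rfl
  | 1 => subset_rfl
  | m + 2 => (Finset.filter_subset _ _).trans (indexSet_subset (m + 1))

lemma mem_indexSet {i : ℕ} (hi : i ∈ Finset.Icc 1 M)
    (h : ∀ m, mt.reject i _ (epochData τ₁ z (m + 1)) (conf M δ (m + 1)) = false) :
    ∀ m, i ∈ indexSet M τ₁ δ mt z m
  | 0 => hi
  | 1 => hi
  | m + 2 => Finset.mem_filter.2 ⟨mem_indexSet hi h (m + 1), h m⟩

lemma currentIndex_mem {i m : ℕ} (hi : i ∈ indexSet M τ₁ δ mt z m) :
    currentIndex M τ₁ δ mt z m ∈ indexSet M τ₁ δ mt z m ∧ currentIndex M τ₁ δ mt z m ≤ i := by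
  rw [currentIndex, dif_pos ⟨i, hi⟩]
  exact ⟨Finset.min'_mem _ _, Finset.min'_le _ _ hi⟩

lemma currentIndex_eq {i m : ℕ} (hi : i ∈ indexSet M τ₁ δ mt z (m + 2))
    (h : ∀ j ∈ Finset.Icc 1 M, j < i →
      mt.reject j _ (epochData τ₁ z (m + 1)) (conf M δ (m + 1)) = true) :
    currentIndex M τ₁ δ mt z (m + 2) = i := by
  obtain ⟨h1, h2⟩ := currentIndex_mem hi
  refine le_antisymm h2 (not_lt.1 fun hlt => ?_)
  have h3 := h _ (indexSet_subset _ h1) hlt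
  rw [indexSet, Finset.mem_filter] at h1
  rw [h1.2] at h3
  exact Bool.noConfusion h3

end IndexSelection

/-! ### Probability of the good event -/

section GoodEvent

lemma measure_compl_le_of_one_sub_le {Ω : Type*} [MeasurableSpace Ω] {P : Measure Ω}
    [IsProbabilityMeasure P] {E : Set Ω} (hE : MeasurableSet E) {ζ : ℝ} (hζ : ζ ∈ Set.Ioo (0 : ℝ) 1)
    (h : ENNReal.ofReal (1 - ζ) ≤ P E) : P Eᶜ ≤ ENNReal.ofReal ζ := by
  rw [prob_compl_eq_one_sub hE, tsub_le_iff_right]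
  calc (1 : ℝ≥0∞) = ENNReal.ofReal ζ + ENNReal.ofReal (1 - ζ) := by
        rw [← ENNReal.ofReal_add hζ.1.le (by linarith [hζ.2])]; simp
    _ ≤ _ := by gcongr

/-- The factor is 9/16 = 1/4 + 1/4 + 1/16 for tests, estimation and concentration, and (9/16)(π²/6)
< 1. -/
lemma tsum_budget_le {δ : ℝ} (hδ : 0 ≤ δ) :
    ∑' k : ℕ, ENNReal.ofReal (9 / 16 * δ / ((k : ℝ) + 1) ^ 2) ≤ ENNReal.ofReal δ := by
  have h1 := (hasSum_nat_add_iff' 1).2 hasSum_zeta_two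
  have h2 := h1.mul_left (9 / 16 * δ)
  have e : (fun k : ℕ => 9 / 16 * δ * (1 / ((k + 1 : ℕ) : ℝ) ^ 2)) =
      fun k : ℕ => 9 / 16 * δ / ((k : ℝ) + 1) ^ 2 := by
    funext k; push_cast; ring
  rw [e] at h2
  rw [← ENNReal.ofReal_tsum_of_nonneg (fun k => by positivity) h2.summable, h2.tsum_eq]
  refine ENNReal.ofReal_le_ofReal ?_
  have hπ := Real.pi_lt_d2
  have hπ0 := Real.pi_pos
  simp only [Finset.range_one, Finset.sum_singleton]
  norm_num
  nlinarith [mul_nonneg hδ hπ0.le]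

lemma conf_mem_Ioo {M : ℕ} (hM : 1 ≤ M) {δ : ℝ} (hδ : δ ∈ Set.Ioo (0 : ℝ) 1) (k : ℕ) :
    conf M δ (k + 1) ∈ Set.Ioo (0 : ℝ) 1 ∧ δ / (4 * ((k : ℝ) + 1) ^ 2) ∈ Set.Ioo (0 : ℝ) 1 ∧
      M * conf M δ (k + 1) = δ / (4 * ((k : ℝ) + 1) ^ 2) := by
  have hM' : (1 : ℝ) ≤ M := by exact_mod_cast hM
  have hδ0 := hδ.1
  have hk : (1 : ℝ) ≤ ((k : ℝ) + 1) ^ 2 :=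
    one_le_pow₀ (by linarith [(Nat.cast_nonneg k : (0 : ℝ) ≤ k)])
  have h1 : (1 : ℝ) ≤ M * ((k : ℝ) + 1) ^ 2 := one_le_mul_of_one_le_of_one_le hM' hk
  have h2 := hδ.2
  simp only [conf]
  push_cast
  refine ⟨⟨by positivity, ?_⟩, ⟨by positivity, ?_⟩, by field_simp⟩
  · rw [div_lt_one (by positivity)]; linarith
  · rw [div_lt_one (by positivity)]; linarith

variable {X A : Type*} [MeasurableSpace X] [Fintype A] [MeasurableSpace A]
  [MeasurableSingletonClass A] {Ω : Type*} [MeasurableSpace Ω] {P : Measure Ω}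
  [IsProbabilityMeasure P] {D : Measure (X × (A → ℝ))} [IsProbabilityMeasure D] {M τ₁ : ℕ}
  {δ C₀ C₁ : ℝ} {d : ℕ → ℕ} {am : ArgmaxRule A} {mt : TestOracle X A} {z : ℕ → Ω → Obs X A}
  {fstar : Model X A} {F : ℕ → Set (Model X A)} {istar : ℕ} {β' : ℕ → ℝ} {β : ℕ → ℝ≥0∞}

omit [MeasurableSingletonClass A] [IsProbabilityMeasure D] in
/-- Except with small probability, the test with the data of epoch `k + 1` accepts the first
realizable class and, late enough, rejects all the smaller ones. -/
lemma TestGuarantee.measure_mistake_le (hτ₁ : 2 ≤ τ₁) (hz : ∀ t, Measurable (z t)) (hC₀ : 1 ≤ C₀)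
    (hC₁ : 0 < C₁) (hδ : δ ∈ Set.Ioo (0 : ℝ) 1) (histar : istar ∈ Finset.Icc 1 M)
    (hd : 0 < d istar) (hreal : maxMisspec D fstar (F istar) = 0)
    (ht : TestGuarantee P z D fstar M τ₁ F d C₀ C₁ δ mt β' β) (k : ℕ) :
    P {ω | ¬ (mt.reject istar _ (epochData τ₁ (fun s => z s ω) (k + 1)) (conf M δ (k + 1)) = false ∧
      (β (istar - 1) < (epochEnd τ₁ (k + 1) : ℝ≥0∞) → ∀ j ∈ Finset.Icc 1 M, j < istar →
        mt.reject j _ (epochData τ₁ (fun s => z s ω) (k + 1)) (conf M δ (k + 1)) = true))} ≤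
      ENNReal.ofReal (δ / (4 * ((k : ℝ) + 1) ^ 2)) := by
  have hi := Finset.mem_Icc.1 histar
  obtain ⟨hconf, -, hMconf⟩ := conf_mem_Ioo (hi.1.trans hi.2) hδ k
  have hmeas : ∀ i b, MeasurableSet {ω | mt.reject i _ (epochData τ₁ (fun s => z s ω) (k + 1))
      (conf M δ (k + 1)) = b} := fun i b =>
    ((mt.measurable_reject i _ _).comp ((measurable_epochData τ₁ (k + 1)).comp
      (measurable_pi_lambda _ hz))) (measurableSet_singleton b)
  -- One possible mistake per class: rejecting `istar`, or accepting a smaller class when it is late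
  -- enough. Larger classes are irrelevant. A union bound over M classes cancels the M in `conf`.
  set B : ℕ → Set Ω := fun i => if i = istar then
      {ω | mt.reject i _ (epochData τ₁ (fun s => z s ω) (k + 1)) (conf M δ (k + 1)) = false}ᶜ
    else if i < istar ∧ β (istar - 1) < (epochEnd τ₁ (k + 1) : ℝ≥0∞) then
      {ω | mt.reject i _ (epochData τ₁ (fun s => z s ω) (k + 1)) (conf M δ (k + 1)) = true}ᶜ
    else ∅ with hB
  have hBle : ∀ i ∈ Finset.Icc 1 M, P (B i) ≤ ENNReal.ofReal (conf M δ (k + 1)) := by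
    intro i hiM
    simp only [hB]
    split_ifs with h1 h2
    · refine measure_compl_le_of_one_sub_le (hmeas i false) hconf
        (ht.accept i hiM (k + 1) (by omega) _ hconf ?_)
      have hβ' : ENNReal.ofReal (β' i) ≠ 0 := by
        simpa using (ht.betaPrime_mem i hiM).1
      rw [h1] at hβ' ⊢
      rw [safeEpoch_eq_top D fstar hτ₁ hC₀ hC₁ hδ histar hd hreal, epochEndTop, if_pos rfl,
        ENNReal.mul_top hβ']
      exact le_top
    · refine measure_compl_le_of_one_sub_le (hmeas i true) hconf
        (ht.reject i hiM (k + 1) (by omega) _ hconf (lt_of_le_of_lt ?_ h2.2))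
      exact ht.beta_mono i (istar - 1) (Finset.mem_Icc.1 hiM).1 (by omega) (by omega)
    · simp
  have hsub : {ω | ¬ (mt.reject istar _ (epochData τ₁ (fun s => z s ω) (k + 1))
      (conf M δ (k + 1)) = false ∧
      (β (istar - 1) < (epochEnd τ₁ (k + 1) : ℝ≥0∞) → ∀ j ∈ Finset.Icc 1 M, j < istar →
        mt.reject j _ (epochData τ₁ (fun s => z s ω) (k + 1)) (conf M δ (k + 1)) = true))} ⊆
      ⋃ i ∈ Finset.Icc 1 M, B i := by
    intro ω hω
    by_contra hcon
    simp only [Set.mem_iUnion, not_exists] at hcon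
    refine hω ⟨?_, fun hβ j hj hlt => ?_⟩
    · have := hcon istar histar
      simp only [hB, if_pos] at this
      exact Set.notMem_compl_iff.1 this
    · have := hcon j hj
      simp only [hB, if_neg hlt.ne] at this
      rw [if_pos ⟨hlt, hβ⟩] at this
      exact Set.notMem_compl_iff.1 this
  calc _ ≤ P (⋃ i ∈ Finset.Icc 1 M, B i) := measure_mono hsub
    _ ≤ ∑ i ∈ Finset.Icc 1 M, P (B i) := measure_biUnion_finset_le _ _
    _ ≤ ∑ i ∈ Finset.Icc 1 M, ENNReal.ofReal (conf M δ (k + 1)) := Finset.sum_le_sum hBle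
    _ = ENNReal.ofReal (δ / (4 * ((k : ℝ) + 1) ^ 2)) := by
      rw [← hMconf, Finset.sum_const, Nat.card_Icc, Nat.add_sub_cancel, nsmul_eq_mul,
        ENNReal.ofReal_mul (Nat.cast_nonneg _), ENNReal.ofReal_natCast]

/-- Except with small probability, the model that is estimated from the data of epoch `k + 1` has
the risk that is guaranteed for the first realizable class. -/
lemma IsRun.measure_risk_gt_le {est : ℕ → EstOracle X A} (hτ₁ : 2 ≤ τ₁)
    (hδ : δ ∈ Set.Ioo (0 : ℝ) 1)
    (histar : istar ∈ Finset.Icc 1 M) (hreal : maxMisspec D fstar (F istar) = 0)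
    (hest : EstGuarantee D fstar M F d C₀ C₁ est)
    (h : IsRun P D M τ₁ δ C₁ d am (est M) mt z) (k : ℕ) :
    P {ω | ¬ risk D fstar (fhat τ₁ (est M) (fun s => z s ω) (k + 2))
      (epochKernel M τ₁ δ C₁ d am (est M) mt (fun s => z s ω) (k + 1)) ≤
        epochRate τ₁ M δ C₁ (d istar) (k + 1)} ≤ ENNReal.ofReal (δ / (4 * ((k : ℝ) + 1) ^ 2)) := by
  have hi := Finset.mem_Icc.1 histar
  obtain ⟨-, hζ, hMconf⟩ := conf_mem_Ioo (hi.1.trans hi.2) hδ k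
  have hM0 : (M : ℝ) ≠ 0 := by
    have : 0 < M := by omega
    positivity
  -- The oracle of index M is used at level M · `conf`, and its division by M restores exactly the
  -- level in `epochRate`.
  have hconf : δ / (4 * ((k : ℝ) + 1) ^ 2) / M = conf M δ (k + 1) := by
    rw [← hMconf, mul_div_cancel_left₀ _ hM0]
  have hmeas : MeasurableSet {ω | risk D fstar (fhat τ₁ (est M) (fun s => z s ω) (k + 2))
      (epochKernel M τ₁ δ C₁ d am (est M) mt (fun s => z s ω) (k + 1)) ≤
        epochRate τ₁ M δ C₁ (d istar) (k + 1)} := by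
    have hr : Measurable fun w : ℕ → Obs X A => risk D fstar (fhat τ₁ (est M) w (k + 2))
        (epochKernel M τ₁ δ C₁ d am (est M) mt w (k + 1)) :=
      measurable_risk D fstar (fun a => measurable_epochKernel M τ₁ δ C₁ d am (est M) mt (k + 1) a)
        fun a => measurable_fhat τ₁ (est M) (k + 2) a
    exact measurableSet_le (hr.comp (measurable_pi_lambda _ h.measurable)) measurable_const
  refine measure_compl_le_of_one_sub_le hmeas hζ (h.le_measure_risk hτ₁ fstar k fun p => ?_)
  refine (hest M (Finset.mem_Icc.2 ⟨hi.1.trans hi.2, le_rfl⟩) p _ (two_le_epochLen hτ₁ k) _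
    hζ).trans (measure_mono fun S hS => ?_)
  have hS' := hS istar histar
  rw [misspec_eq_zero D fstar hreal p, mul_zero, zero_add, hconf] at hS'
  exact hS'

/-- Except with small probability, the regret of the first `k + 1` rounds is not much larger than
the sum of its conditional expectations. -/
lemma IsRun.measure_regret_gt_le {est : EstOracle X A} (hτ₁ : 2 ≤ τ₁) (hδ : δ ∈ Set.Ioo (0 : ℝ) 1)
    (fstar : Model X A) (h : IsRun P D M τ₁ δ C₁ d am est mt z) (k : ℕ) :
    P {ω | ¬ regret fstar am (fun s => z s ω) (k + 1) ≤
      ∑ s ∈ Finset.Icc 1 (k + 1), expGap D am fstar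
        (epochKernel M τ₁ δ C₁ d am est mt (fun s => z s ω) (epochIdx τ₁ s)) +
      √((k + 1 : ℕ) * Real.log (16 * ((k + 1 : ℕ) : ℝ) ^ 2 / δ) / 2)} ≤
      ENNReal.ofReal (δ / (16 * ((k : ℝ) + 1) ^ 2)) := by
  have hδ0 := hδ.1
  have hk : (1 : ℝ) ≤ (((k + 1 : ℕ) : ℝ)) ^ 2 := one_le_pow₀ (by
    push_cast; linarith [(Nat.cast_nonneg k : (0 : ℝ) ≤ k)])
  have hone : 1 ≤ 16 * ((k + 1 : ℕ) : ℝ) ^ 2 / δ := by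
    rw [le_div_iff₀ hδ0]; linarith [hδ.2]
  have hY : Measurable fun o : Obs X A => gap am fstar o.1 o.2.1 := by
    have h1 : Measurable fun q : X × A => gap am fstar q.1 q.2 :=
      measurable_from_prod_countable_left fun a => measurable_gap am fstar a
    exact h1.comp (measurable_fst.prodMk (measurable_fst.comp measurable_snd))
  have haz := (h.hasStepLaws hτ₁).measure_sum_gt_le hY
    (fun o => ⟨gap_nonneg am fstar _ _, gap_le_one am fstar _ _⟩) (by omega : 1 ≤ k + 1)
    (Real.log_nonneg hone)
  have hexp : Real.exp (-Real.log (16 * ((k + 1 : ℕ) : ℝ) ^ 2 / δ)) =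
      δ / (16 * ((k : ℝ) + 1) ^ 2) := by
    rw [Real.exp_neg, Real.exp_log (by linarith), inv_div]; push_cast; rfl
  rw [hexp] at haz
  refine le_trans (measure_mono fun ω hω => ?_) haz
  have hω' := not_le.1 hω
  have hmean : ∀ p : ProbKernel X A, ∫ o, gap am fstar o.1 o.2.1 ∂samplingLaw D p =
      expGap D am fstar p := fun p =>
    integral_samplingLaw D p (measurable_gap am fstar) hY (gap_nonneg am fstar)
  simp only [Set.mem_ofPred_eq, hmean, Finset.sum_sub_distrib]
  have hreg : regret fstar am (fun s => z s ω) (k + 1) =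
      ∑ s ∈ Finset.Icc 1 (k + 1), gap am fstar (z s ω).1 (z s ω).2.1 := rfl
  rw [hreg] at hω'
  linarith

/-- With probability at least `1 - δ`, simultaneously for all epochs and all rounds, the tests make
no mistakes, the estimated models are accurate, and the regret is concentrated. -/
theorem IsRun.one_sub_le_measure_good {est : ℕ → EstOracle X A} (hτ₁ : 2 ≤ τ₁) (hC₀ : 1 ≤ C₀)
    (hC₁ : 0 < C₁) (hδ : δ ∈ Set.Ioo (0 : ℝ) 1) (histar : istar ∈ Finset.Icc 1 M)
    (hd : 0 < d istar) (hreal : maxMisspec D fstar (F istar) = 0)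
    (hest : EstGuarantee D fstar M F d C₀ C₁ est)
    (h : IsRun P D M τ₁ δ C₁ d am (est M) mt z)
    (ht : TestGuarantee P z D fstar M τ₁ F d C₀ C₁ δ mt β' β) :
    ENNReal.ofReal (1 - δ) ≤ P {ω | ∀ k : ℕ,
      (mt.reject istar _ (epochData τ₁ (fun s => z s ω) (k + 1)) (conf M δ (k + 1)) = false ∧
      (β (istar - 1) < (epochEnd τ₁ (k + 1) : ℝ≥0∞) → ∀ j ∈ Finset.Icc 1 M, j < istar →
        mt.reject j _ (epochData τ₁ (fun s => z s ω) (k + 1)) (conf M δ (k + 1)) = true)) ∧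
      risk D fstar (fhat τ₁ (est M) (fun s => z s ω) (k + 2))
        (epochKernel M τ₁ δ C₁ d am (est M) mt (fun s => z s ω) (k + 1)) ≤
          epochRate τ₁ M δ C₁ (d istar) (k + 1) ∧
      regret fstar am (fun s => z s ω) (k + 1) ≤
        ∑ s ∈ Finset.Icc 1 (k + 1), expGap D am fstar
          (epochKernel M τ₁ δ C₁ d am (est M) mt (fun s => z s ω) (epochIdx τ₁ s)) +
        √((k + 1 : ℕ) * Real.log (16 * ((k + 1 : ℕ) : ℝ) ^ 2 / δ) / 2)} := by
  have h1 := ht.measure_mistake_le hτ₁ h.measurable hC₀ hC₁ hδ histar hd hreal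
  have h2 := h.measure_risk_gt_le hτ₁ hδ histar hreal hest
  have h3 := h.measure_regret_gt_le hτ₁ hδ fstar
  have hδ0 := hδ.1
  -- The three events become opaque predicates, so that the union bound is purely set-theoretic.
  generalize hE1 : (fun (k : ℕ) (ω : Ω) =>
    (mt.reject istar _ (epochData τ₁ (fun s => z s ω) (k + 1)) (conf M δ (k + 1)) = false ∧
      (β (istar - 1) < (epochEnd τ₁ (k + 1) : ℝ≥0∞) → ∀ j ∈ Finset.Icc 1 M, j < istar →
        mt.reject j _ (epochData τ₁ (fun s => z s ω) (k + 1)) (conf M δ (k + 1)) = true))) = E1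
  generalize hE2 : (fun (k : ℕ) (ω : Ω) =>
    risk D fstar (fhat τ₁ (est M) (fun s => z s ω) (k + 2))
        (epochKernel M τ₁ δ C₁ d am (est M) mt (fun s => z s ω) (k + 1)) ≤
          epochRate τ₁ M δ C₁ (d istar) (k + 1)) = E2
  generalize hE3 : (fun (k : ℕ) (ω : Ω) => regret fstar am (fun s => z s ω) (k + 1) ≤
        ∑ s ∈ Finset.Icc 1 (k + 1), expGap D am fstar
          (epochKernel M τ₁ δ C₁ d am (est M) mt (fun s => z s ω) (epochIdx τ₁ s)) +
        √((k + 1 : ℕ) * Real.log (16 * ((k + 1 : ℕ) : ℝ) ^ 2 / δ) / 2)) = E3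
  replace h1 : ∀ k : ℕ, P {ω | ¬ E1 k ω} ≤ ENNReal.ofReal (δ / (4 * ((k : ℝ) + 1) ^ 2)) := by
    rw [← hE1]; exact h1
  replace h2 : ∀ k : ℕ, P {ω | ¬ E2 k ω} ≤ ENNReal.ofReal (δ / (4 * ((k : ℝ) + 1) ^ 2)) := by
    rw [← hE2]; exact h2
  replace h3 : ∀ k : ℕ, P {ω | ¬ E3 k ω} ≤ ENNReal.ofReal (δ / (16 * ((k : ℝ) + 1) ^ 2)) := by
    rw [← hE3]; exact h3
  have hbad : P (⋃ k, (({ω | ¬ E1 k ω} ∪ {ω | ¬ E2 k ω}) ∪ {ω | ¬ E3 k ω})) ≤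
      ENNReal.ofReal δ := by
    refine (measure_iUnion_le _).trans (le_trans (ENNReal.tsum_le_tsum fun k => ?_)
      (tsum_budget_le hδ0.le))
    have e : 9 / 16 * δ / ((k : ℝ) + 1) ^ 2 = δ / (4 * ((k : ℝ) + 1) ^ 2) +
        δ / (4 * ((k : ℝ) + 1) ^ 2) + δ / (16 * ((k : ℝ) + 1) ^ 2) := by
      field_simp; norm_num
    rw [e, ENNReal.ofReal_add (by positivity) (by positivity),
      ENNReal.ofReal_add (by positivity) (by positivity)]
    exact (measure_union_le _ _).trans
      (add_le_add ((measure_union_le _ _).trans (add_le_add (h1 k) (h2 k))) (h3 k))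
  have hgoal : ENNReal.ofReal (1 - δ) ≤ P {ω | ∀ k, E1 k ω ∧ E2 k ω ∧ E3 k ω} := by
    have hun : (1 : ℝ≥0∞) ≤ P {ω | ∀ k, E1 k ω ∧ E2 k ω ∧ E3 k ω} + ENNReal.ofReal δ := by
      rw [← measure_univ (μ := P)]
      refine le_trans (measure_mono fun ω _ => ?_)
        ((measure_union_le _ _).trans (add_le_add le_rfl hbad))
      by_cases hω : ∀ k, E1 k ω ∧ E2 k ω ∧ E3 k ω
      · exact Or.inl hω
      · obtain ⟨k, hk⟩ := not_forall.1 hω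
        refine Or.inr (Set.mem_iUnion.2 ⟨k, ?_⟩)
        simp only [Set.mem_union, Set.mem_ofPred_eq]
        tauto
    rw [ENNReal.ofReal_sub _ hδ0.le, ENNReal.ofReal_one]
    exact tsub_le_iff_right.2 hun
  rw [← hE1, ← hE2, ← hE3] at hgoal
  exact hgoal

end GoodEvent

/-- An epoch from which on the current class index is adequate, and which ends early enough. -/
lemma exists_start_epoch {τ₁ d₁ ds : ℕ} (hd₁ : 0 < d₁) (hτ₁ : 2 ≤ τ₁) {b : ℝ≥0∞}
    (hb : 3 * d₁ < ds → b ≠ ⊤) :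
    ∃ m₀, 2 ≤ m₀ ∧
      (ds ≤ 3 * d₁ ∨ ∀ k, m₀ ≤ k + 2 → b < (epochEnd τ₁ (k + 1) : ℝ≥0∞)) ∧
      ENNReal.ofReal (epochEnd τ₁ m₀) ≤ ENNReal.ofReal (2 * τ₁) +
        4 * (b * ENNReal.ofReal (Real.log ((ds : ℝ) / d₁))) := by
  have h2 : epochEnd τ₁ 2 = 2 * τ₁ := rfl
  by_cases hcase : ds ≤ 3 * d₁
  -- Every dimension between `d₁` and `ds` is already within a factor 3 of `ds`, so no rejection is
  -- required.
  · refine ⟨2, le_rfl, Or.inl hcase, ?_⟩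
    rw [h2]
    push_cast
    exact le_self_add
  · rw [not_le] at hcase
    have hlog : (1 : ℝ) ≤ Real.log ((ds : ℝ) / d₁) := by
      have hd₁' : (0 : ℝ) < d₁ := by exact_mod_cast hd₁
      have h3 : (3 : ℝ) ≤ (ds : ℝ) / d₁ := by
        rw [le_div_iff₀ hd₁']; exact_mod_cast hcase.le
      exact (by norm_num : (1 : ℝ) ≤ 1.05).trans
        (le_log_three.trans (Real.log_le_log (by norm_num) h3))
    have hb' : b ≤ b * ENNReal.ofReal (Real.log ((ds : ℝ) / d₁)) :=
      le_mul_of_one_le_right (zero_le) (by simpa using hlog)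
    have hex : ∃ k, b < (epochEnd τ₁ (k + 1) : ℝ≥0∞) := by
      obtain ⟨n, hn⟩ := ENNReal.exists_nat_gt (hb hcase)
      refine ⟨n, hn.trans ?_⟩
      exact_mod_cast lt_epochEnd hτ₁ n
    classical
    -- The index of epoch k + 2 uses the test on the data of epoch k + 1, hence m₀ = k₀ + 2. If k₀ >
    -- 0, minimality gives τ_{k₀} ≤ b, so τ_{m₀} = 4 τ_{k₀} ≤ 4 b.
    set k₀ := Nat.find hex with hk₀
    refine ⟨k₀ + 2, by omega, Or.inr fun k hk => ?_, ?_⟩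
    · refine (Nat.find_spec hex).trans_le ?_
      exact_mod_cast epochEnd_mono τ₁ (by omega : k₀ + 1 ≤ k + 1)
    · rcases hk : k₀ with _ | j
      · rw [zero_add, h2]
        push_cast
        exact le_self_add
      · have hj := not_lt.1 (Nat.find_min hex (by omega : j < Nat.find hex))
        have e : ENNReal.ofReal (epochEnd τ₁ (j + 1 + 2) : ℝ) = 4 * (epochEnd τ₁ (j + 1) : ℝ≥0∞) := by
          rw [ENNReal.ofReal_natCast, epochEnd_succ_succ, epochEnd_succ_succ]
          push_cast
          ring
        rw [e]
        exact (mul_le_mul_right (hj.trans hb') _).trans le_add_self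

end ModIGW

/-! ### Assembly of the regret bound -/

open ModIGW
theorem corollary3 (τ₁ : ℕ) (hτ₁ : 2 ≤ τ₁) (C₁ : ℝ) (hC₁ : 0 < C₁) :
    -- the constant hidden in the O-notation depends on `τ₁` and `C₁` only
    ∃ C : ℝ, 0 < C ∧
      ∀ (X A Ω : Type*) [MeasurableSpace X] [Fintype A] [Nonempty A] [MeasurableSpace A]
        [MeasurableSingletonClass A] [MeasurableSpace Ω]
        -- the environment: contexts and reward vectors in `[0,1]^K` with law `D`
        (D : Measure (X × (A → ℝ))) [IsProbabilityMeasure D]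
        (_ : ∀ᵐ w ∂D, ∀ a, w.2 a ∈ Set.Icc (0 : ℝ) 1)
        (fstar : Model X A) (_ : IsMeanReward D fstar)
        -- the model classes and their VC subgraph dimensions `1 ≤ d 1 ≤ ⋯ ≤ d M < ∞`
        (M : ℕ) (F : ℕ → Set (Model X A)) (d : ℕ → ℕ)
        (_ : ∀ i ∈ Finset.Icc 1 M, vcSubgraphDim (F i) = (d i : ℕ∞))
        (_ : 0 < d 1) (_ : ∀ i j, 1 ≤ i → i ≤ j → j ≤ M → d i ≤ d j)
        -- realizability, with `istar` the smallest index of a realizable class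
        (istar : ℕ)
        (_ : IsLeast {i | i ∈ Finset.Icc 1 M ∧ maxMisspec D fstar (F i) = 0} istar)
        -- the estimation oracles
        (C₀ : ℝ) (_ : 1 ≤ C₀) (est : ℕ → EstOracle X A)
        (_ : EstGuarantee D fstar M F d C₀ C₁ est)
        -- a run of the algorithm, with the oracle `est M` and the test `mt`
        (δ : ℝ) (_ : δ ∈ Set.Ioo (0 : ℝ) 1) (am : ArgmaxRule A) (mt : TestOracle X A)
        (P : Measure Ω) [IsProbabilityMeasure P] (z : ℕ → Ω → Obs X A)
        (_ : IsRun P D M τ₁ δ C₁ d am (est M) mt z)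
        -- the misspecification test
        (β' : ℕ → ℝ) (β : ℕ → ℝ≥0∞)
        (_ : TestGuarantee P z D fstar M τ₁ F d C₀ C₁ δ mt β' β),
        ENNReal.ofReal (1 - δ) ≤ P {ω | ∀ t : ℕ, 3 ≤ t →
          ENNReal.ofReal (regret fstar am (fun s => z s ω) t) ≤ ENNReal.ofReal C *
            (β (istar - 1) * ENNReal.ofReal (Real.log ((d istar : ℝ) / d 1)) +
              ENNReal.ofReal √((Fintype.card A : ℝ) * d istar * t * Real.log t *
                Real.log (M * Real.log t / δ)))} := by

  refine ⟨24 * τ₁ + 8 + 300 * √(70 * C₁), by positivity, ?_⟩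
  intro X A Ω _ _ _ _ _ _ D _ _ fstar _ M F d _ hd1 hdmono istar hleast C₀ hC₀ est hest δ hδ am mt
    P _ z hrun β' β htest
  obtain ⟨⟨histar, hreal⟩, -⟩ := hleast
  have hi := Finset.mem_Icc.1 histar
  have hM : 1 ≤ M := hi.1.trans hi.2
  have hd1s : d 1 ≤ d istar := hdmono 1 istar le_rfl hi.1 hi.2
  have hds : 0 < d istar := hd1.trans_le hd1s
  -- If this fails, the logarithm is positive and β is infinite, so the right-hand side is infinite.
  by_cases hb : 3 * d 1 < d istar → β (istar - 1) ≠ ⊤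
  swap
  · rw [Classical.not_imp, not_not] at hb
    have hd1' : (0 : ℝ) < d 1 := by exact_mod_cast hd1
    have hlog : 0 < Real.log ((d istar : ℝ) / d 1) := by
      refine Real.log_pos ?_
      rw [lt_div_iff₀ hd1', one_mul]
      exact_mod_cast (by omega : d 1 < d istar)
    have htop : β (istar - 1) * ENNReal.ofReal (Real.log ((d istar : ℝ) / d 1)) = ⊤ := by
      rw [hb.2, ENNReal.top_mul (by simpa using hlog)]
    have hCne : ENNReal.ofReal (24 * τ₁ + 8 + 300 * √(70 * C₁)) ≠ 0 := by
      have : 0 < 24 * (τ₁ : ℝ) + 8 + 300 * √(70 * C₁) := by positivity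
      simpa using this
    simp only [htop, top_add, ENNReal.mul_top hCne, le_top, implies_true, Set.ofPred_true,
      measure_univ]
    exact ENNReal.ofReal_le_one.2 (by linarith [hδ.1])
  obtain ⟨m₀, hm₀, hadeq, hTm₀⟩ := exists_start_epoch hd1 hτ₁ hb
  refine (hrun.one_sub_le_measure_good hτ₁ hC₀ hC₁ hδ histar hds hreal hest htest).trans
    (measure_mono fun ω hω t ht => ?_)
  set w : ℕ → Obs X A := fun s => z s ω
  have hmem : ∀ m, istar ∈ indexSet M τ₁ δ mt w m := mem_indexSet histar fun k => (hω k).1.1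
  have hidx : ∀ m, m₀ ≤ m → 0 < d (currentIndex M τ₁ δ mt w m) ∧
      d (currentIndex M τ₁ δ mt w m) ≤ d istar ∧
      d istar ≤ 3 * d (currentIndex M τ₁ δ mt w m) := by
    intro m hm
    obtain ⟨k, rfl⟩ : ∃ k, m = k + 2 := ⟨m - 2, by omega⟩
    obtain ⟨c1, c2⟩ := currentIndex_mem (hmem (k + 2))
    have c3 := Finset.mem_Icc.1 (indexSet_subset _ c1)
    have c4 := hdmono 1 _ le_rfl c3.1 c3.2
    have c5 := hdmono _ istar c3.1 c2 hi.2
    refine ⟨hd1.trans_le c4, c5, ?_⟩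
    rcases hadeq with h | h
    · omega
    · rw [currentIndex_eq (hmem (k + 2)) ((hω k).1.2 (h k hm))]; omega
  have hsum := sum_expGap_le D hτ₁ hM hδ hC₁ am fstar (est M) mt w hm₀ (fun m hm => by
    obtain ⟨k, rfl⟩ : ∃ k, m = k + 1 := ⟨m - 1, by omega⟩
    exact (hω k).2.1) hidx ht
  obtain ⟨k, rfl⟩ : ∃ k, t = k + 1 := ⟨t - 1, by omega⟩
  have hreg := (hω k).2.2
  obtain ⟨hlt, hL, -⟩ := log_bounds hM hδ ht
  have hl16 := log_sixteen_mul_sq_div_le hM hδ ht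
  have hK : (1 : ℝ) ≤ Fintype.card A := by exact_mod_cast Fintype.card_pos (α := A)
  have hdr : (1 : ℝ) ≤ d istar := by exact_mod_cast hds
  have ht3 : (3 : ℝ) ≤ ((k + 1 : ℕ) : ℝ) := by exact_mod_cast ht
  set T : ℝ := ((k + 1 : ℕ) : ℝ)
  set L := Real.log (M * Real.log T / δ)
  have hKd : 1 ≤ (Fintype.card A : ℝ) * d istar := one_le_mul_of_one_le_of_one_le hK hdr
  have hlL : 0.05 ≤ Real.log T * L := by nlinarith
  have hle : T * (Real.log T * L) ≤ Fintype.card A * d istar * T * Real.log T * L := by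
    calc T * (Real.log T * L) ≤ (Fintype.card A * d istar) * (T * (Real.log T * L)) :=
          le_mul_of_one_le_left (by positivity) hKd
      _ = _ := by ring
  set V := Fintype.card A * d istar * T * Real.log T * L
  -- The quantity under the root is at most 55 V by `hl16` and `hle`, and 55 ≤ 64.
  have hdev : √(T * Real.log (16 * T ^ 2 / δ) / 2) ≤ 8 * √V := by
    rw [show (8 : ℝ) = √64 by rw [show (64 : ℝ) = 8 ^ 2 by norm_num, Real.sqrt_sq (by norm_num)],
      ← Real.sqrt_mul (by norm_num)]
    refine Real.sqrt_le_sqrt ?_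
    nlinarith
  -- Since V ≥ 3 · 0.05, the constant burn-in 4τ₁ can be charged to √V.
  have hV : 1 ≤ 3 * √V := by
    have : 1 / 3 ≤ √V := Real.le_sqrt_of_sq_le (by nlinarith)
    linarith
  have hfinal : regret fstar am w (k + 1) ≤
      2 * epochEnd τ₁ m₀ + (8 + 300 * √(70 * C₁)) * √V := by linarith
  have hτV : (4 : ℝ) * τ₁ ≤ 24 * τ₁ * √V := by
    have : (0 : ℝ) ≤ τ₁ := Nat.cast_nonneg _
    nlinarith
  set H := β (istar - 1) * ENNReal.ofReal (Real.log ((d istar : ℝ) / d 1))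
  calc ENNReal.ofReal (regret fstar am w (k + 1))
      ≤ ENNReal.ofReal (2 * epochEnd τ₁ m₀ + (8 + 300 * √(70 * C₁)) * √V) :=
        ENNReal.ofReal_le_ofReal hfinal
    _ = 2 * ENNReal.ofReal (epochEnd τ₁ m₀) +
        ENNReal.ofReal ((8 + 300 * √(70 * C₁)) * √V) := by
      rw [ENNReal.ofReal_add (by positivity) (by positivity), ENNReal.ofReal_mul (by norm_num)]
      norm_num
    _ ≤ 2 * (ENNReal.ofReal (2 * τ₁) + 4 * H) +
        ENNReal.ofReal ((8 + 300 * √(70 * C₁)) * √V) := by gcongr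
    _ = 8 * H + ENNReal.ofReal (4 * τ₁ + (8 + 300 * √(70 * C₁)) * √V) := by
      have h4 : ENNReal.ofReal (4 * τ₁) = 2 * ENNReal.ofReal (2 * τ₁) := by
        rw [show (4 : ℝ) * τ₁ = 2 * (2 * τ₁) by ring, ENNReal.ofReal_mul (p := 2) (by norm_num),
          ENNReal.ofReal_ofNat]
      rw [ENNReal.ofReal_add (p := 4 * τ₁) (by positivity) (by positivity), h4]
      ring
    _ ≤ ENNReal.ofReal (24 * τ₁ + 8 + 300 * √(70 * C₁)) * H +
        ENNReal.ofReal (24 * τ₁ + 8 + 300 * √(70 * C₁)) * ENNReal.ofReal √V := by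
      gcongr
      · rw [← ENNReal.ofReal_ofNat]
        refine ENNReal.ofReal_le_ofReal ?_
        have h1 : 0 ≤ √(70 * C₁) := Real.sqrt_nonneg _
        have h2 : (0 : ℝ) ≤ τ₁ := Nat.cast_nonneg _
        linarith
      · rw [← ENNReal.ofReal_mul (by positivity)]
        exact ENNReal.ofReal_le_ofReal (by linarith)
    _ = _ := by rw [mul_add]
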